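/- Let $\mathcal{G}=(\mathcal{V},\mathcal{E},A)$ be a weighted digraph with nodes $v_1,\dots,v_n$ and adjacency matrix $A=[a_{ij}]$, where $a_{ij}\ge 0$, $a_{ii}=0$, and $a_{ij}>0$ if and only if there is an edge from $v_j$ to $v_i$. Let $L=\Delta-A$ be its Laplacian, where $\Delta$ is the diagonal matrix with entries $\Delta_{ii}=\sum_{j}a_{ij}$. Suppose that $\mathcal{G}$ contains a directed spanning tree, i.e. a set of edges such that no edge of the set ends at a certain node (the root), exactly one edge of the set ends at each other node, and every node is reached from the root by a directed path in the set. Let $\bar f:\mathbb{R}\to\mathbb{R}$ be a (not necessarily strictly) increasing, possibly discontinuous function with $\lim_{s\to\infty}|\bar f(s)|=\infty$, and let $$\mathcal{F}[\bar f](s)=\bigcap_{\delta>0}\ \bigcap_{\mu(S)=0}\overline{\mathrm{co}}\,\bar f\big((s-\delta,s+\delta)\setminus S\big)$$ be its Filippov set-valued map, where $\mu$ is Lebesgue measure and $\overline{\mathrm{co}}$ is the closed convex hull. Consider the differential inclusion $$\dot x\in -L\Big(\mathcal{F}[\bar f](x_1)\times\cdots\times\mathcal{F}[\bar f](x_n)\Big),\qquad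 x\in\mathbb{R}^n. \tag{1}$$ A solution of (1) on a time interval $I=[0,t_1]$, $[0,t_1)$ or $[0,\infty)$ is a function that is absolutely continuous on each compact interval $[0,t]\subseteq I$ and satisfies (1) for almost all $t\in I$; it is maximal if it is not the restriction of a solution on a larger interval. Let $$\mathcal{D}_2=\Big\{x\in\mathbb{R}^n \ \Big|\ \exists a\in\mathbb{R}:\ a\mathbf{1}_n\in \mathcal{F}[\bar f](x_1)\times\cdots\times\mathcal{F}[\bar f](x_n)\Big\}.$$ Then: 1. every solution of (1) is bounded on its interval of definition; 2. every maximal solution $x$ of (1) is defined on $[0,\infty)$ and converges to $\mathcal{D}_2$, i.e. $\mathrm{dist}(x(t),\mathcal{D}_2)\to 0$ as $t\to\infty$; 3. $\mathcal{D}_2$ is strongly invariant: every maximal solution of (1) that starts in $\mathcal{D}_2$ stays in $\mathcal{D}_2$. -/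

import Mathlib

open Set Filter Topology MeasureTheory

noncomputable section

/-- A weighted digraph on the nodes `0, …, n - 1`: an edge set `E`, where `(j, i) ∈ E` is the edge
from node `j` to node `i`, and a nonnegative adjacency matrix `A` with zero diagonal such that
`A i j > 0` exactly when there is an edge from `j` to `i`. -/
structure WeightedDigraph (n : ℕ) where
  E : Set (Fin n × Fin n)
  A : Matrix (Fin n) (Fin n) ℝ
  nonneg : ∀ i j, 0 ≤ A i j
  pos_iff : ∀ i j, 0 < A i j ↔ (j, i) ∈ E
  diag_zero : ∀ i, A i i = 0

namespace WeightedDigraph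

variable {n : ℕ}

/-- The in-degree of the node `i`. -/
def inDegree (G : WeightedDigraph n) (i : Fin n) : ℝ := ∑ j, G.A i j

/-- The graph Laplacian `L = Δ - A`, where `Δ` is the diagonal matrix of the in-degrees. -/
def laplacian (G : WeightedDigraph n) : Matrix (Fin n) (Fin n) ℝ :=
  Matrix.diagonal G.inDegree - G.A

/-- `T` is the edge set of a directed spanning tree of `G` with root `r`: the edges of `T` are edges
of `G`, no edge of `T` ends at `r`, exactly one edge of `T` ends at each other node, and each node
is reached from `r` by a directed path in `T`. -/
def IsSpanningTree (G : WeightedDigraph n) (T : Set (Fin n × Fin n)) (r : Fin n) : Prop :=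
  T ⊆ G.E ∧ (∀ j, (j, r) ∉ T) ∧ (∀ i, i ≠ r → ∃! j, (j, i) ∈ T) ∧
    ∀ i, Relation.ReflTransGen (fun a b => (a, b) ∈ T) r i

/-- `G` contains a directed spanning tree. -/
def HasSpanningTree (G : WeightedDigraph n) : Prop :=
  ∃ T r, G.IsSpanningTree T r

end WeightedDigraph

/-- The Filippov set-valued map `F[X]` of `X`: the intersection, over all `δ > 0` and all Lebesgue
null sets `S`, of the closed convex hulls of `X (B(x, δ) \ S)`. -/
def filippov {E F : Type*} [PseudoMetricSpace E] [MeasureSpace E] [AddCommGroup F] [Module ℝ F]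
    [TopologicalSpace F] (X : E → F) (x : E) : Set F :=
  ⋂ (δ : ℝ) (_ : 0 < δ) (S : Set E) (_ : volume S = 0),
    closure (convexHull ℝ (X '' (Metric.ball x δ \ S)))

/-- The right-hand side `x ↦ -L (F[f₁](x₁) × ⋯ × F[fₙ](xₙ))` of the differential inclusion of the
consensus protocol `x' = -L f(x)`. -/
def consensusMap {n : ℕ} (G : WeightedDigraph n) (f : Fin n → ℝ → ℝ) (x : Fin n → ℝ) :
    Set (Fin n → ℝ) :=
  (fun ν => -(G.laplacian.mulVec ν)) '' Set.univ.pi fun i => filippov (f i) (x i)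

/-- The set of all `x` for which some constant vector `a·1` lies in
`F[f₁](x₁) × ⋯ × F[fₙ](xₙ)`. -/
def consensusSet {n : ℕ} (f : Fin n → ℝ → ℝ) : Set (Fin n → ℝ) :=
  {x | ∃ a : ℝ, (fun _ => a) ∈ Set.univ.pi fun i => filippov (f i) (x i)}

/-- `x` is a solution of the differential inclusion `x' ∈ K(x)` on the time interval `I`, which is
`[0, t₁]`, `[0, t₁)` or `[0, ∞)`: it is absolutely continuous on each `[0, t] ⊆ I` and satisfies the
inclusion at almost all times in `I`. The values of `x` outside `I` play no role. -/
structure IsSolution {n : ℕ} (K : (Fin n → ℝ) → Set (Fin n → ℝ)) (I : Set ℝ) (x : ℝ → Fin n → ℝ) :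
    Prop where
  ordConnected : I.OrdConnected
  zero_mem : 0 ∈ I
  nonneg : ∀ t ∈ I, 0 ≤ t
  absolutelyContinuous : ∀ t ∈ I, AbsolutelyContinuousOnInterval x 0 t
  inclusion : ∀ᵐ t ∂volume, t ∈ I → ∃ v ∈ K (x t), HasDerivWithinAt x v I t

/-- A solution is maximal if it is not the restriction of a solution on a larger interval. -/
def IsMaximalSolution {n : ℕ} (K : (Fin n → ℝ) → Set (Fin n → ℝ)) (I : Set ℝ)
    (x : ℝ → Fin n → ℝ) : Prop :=
  IsSolution K I x ∧ ∀ J y, IsSolution K J y → I ⊆ J → EqOn y x I → J = I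

/-- `R` is strongly invariant for `x' ∈ K(x)`: every maximal solution starting in `R` stays in
`R`. -/
def StronglyInvariant {n : ℕ} (K : (Fin n → ℝ) → Set (Fin n → ℝ)) (R : Set (Fin n → ℝ)) : Prop :=
  ∀ x₀ ∈ R, ∀ I x, IsMaximalSolution K I x → x 0 = x₀ → ∀ t ∈ I, x t ∈ R

/-- The distance of `x t` to the set `R` tends to `0` as `t → ∞` (this fails if `R` is empty). -/
def ConvergesToSet {n : ℕ} (x : ℝ → Fin n → ℝ) (R : Set (Fin n → ℝ)) : Prop :=
  ∀ ε > 0, ∀ᶠ t in atTop, ∃ y ∈ R, dist (x t) y < ε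

end

/-! For monotone `f`, the Filippov set at `s` is the interval between the one-sided limits of `f`
(`Monotone.mem_filippov_iff`), so a larger state never has a smaller selected value. Among the nodes
of largest state, one with the largest selected value cannot move up; hence the maximum decreases
and, by reflection, the minimum increases (`IsTrajectory.sup'_le`). This gives boundedness, and also
invariance of the consensus set. Euler schemes provide solutions from every initial value, so
maximal solutions live on `[0, ∞)`.

For convergence, let `M` and `-m` be the limits of the maximum and the minimum. It suffices that
`f(M-) ≤ f((-m)+)`: then `f(M-)` is a selected value at every point of `[-m, M]`, and clamping the
state to this interval yields a nearby point of the consensus set. To get the inequality, pass to a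
limit `y` of translates, along which the maximum is constantly `M` and the minimum constantly `-m`
(`exists_isFlow_of_translates`). Selections do not converge pointwise, but their integrals `N` do,
and the derivative of `N` is again a selection.

The key is `IsFlow.exists_deficit_le`: when the maximum stays at `M`, the integral of the selected
value at a root of the graph is at least `f(M-) t` up to a constant. Applied to the reflected flow,
it says that the same integral at the same root is at most `f((-m)+) t` up to a constant. Letting
`t` grow compares the two slopes. -/

/-! ### Growth of absolutely continuous functions. -/

/-- An absolutely continuous function whose derivative is a.e. at most `C` grows at most at
rate `C`. -/
theorem AbsolutelyContinuousOnInterval.sub_le_of_ae_hasDerivAt_le {u : ℝ → ℝ} {a b C : ℝ}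
    (hab : a ≤ b) (hu : AbsolutelyContinuousOnInterval u a b)
    (h : ∀ᵐ t, t ∈ Ioo a b → ∃ d ≤ C, HasDerivAt u d t) : u b - u a ≤ C * (b - a) := by
  rw [← hu.integral_deriv_eq_sub]
  have h1 : ∫ t in a..b, deriv u t ≤ ∫ _ in a..b, C := by
    refine intervalIntegral.integral_mono_ae_restrict hab hu.intervalIntegrable_deriv
      intervalIntegrable_const ?_
    rw [EventuallyLE, ae_restrict_iff' measurableSet_Icc]
    have ha : ∀ᵐ t : ℝ, t ≠ a := by simp [ae_iff, measure_singleton]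
    have hb : ∀ᵐ t : ℝ, t ≠ b := by simp [ae_iff, measure_singleton]
    filter_upwards [h, ha, hb] with t ht hta htb htI
    obtain ⟨d, hd, hd'⟩ := ht ⟨lt_of_le_of_ne htI.1 (Ne.symm hta), lt_of_le_of_ne htI.2 htb⟩
    rwa [hd'.deriv]
  refine h1.trans (le_of_eq ?_)
  simp [mul_comm]

theorem AbsolutelyContinuousOnInterval.le_sub_of_ae_le_hasDerivAt {u : ℝ → ℝ} {a b C : ℝ}
    (hab : a ≤ b) (hu : AbsolutelyContinuousOnInterval u a b)
    (h : ∀ᵐ t, t ∈ Ioo a b → ∃ d, C ≤ d ∧ HasDerivAt u d t) : C * (b - a) ≤ u b - u a := by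
  have := hu.neg.sub_le_of_ae_hasDerivAt_le (C := -C) hab (by
    filter_upwards [h] with t ht htI
    obtain ⟨d, hd, hd'⟩ := ht htI
    exact ⟨-d, by linarith, hd'.neg⟩)
  simp only [Pi.neg_apply] at this
  linarith

theorem AbsolutelyContinuousOnInterval.abs_sub_le_of_ae_hasDerivAt {u : ℝ → ℝ} {a b C : ℝ}
    (hab : a ≤ b) (hu : AbsolutelyContinuousOnInterval u a b)
    (h : ∀ᵐ t, t ∈ Ioo a b → ∃ d, |d| ≤ C ∧ HasDerivAt u d t) : |u b - u a| ≤ C * (b - a) := by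
  rw [abs_le]
  have h1 := hu.sub_le_of_ae_hasDerivAt_le (C := C) hab (by
    filter_upwards [h] with t ht htI
    obtain ⟨d, hd, hd'⟩ := ht htI
    exact ⟨d, (abs_le.1 hd).2, hd'⟩)
  have h2 := hu.le_sub_of_ae_le_hasDerivAt (C := -C) hab (by
    filter_upwards [h] with t ht htI
    obtain ⟨d, hd, hd'⟩ := ht htI
    exact ⟨d, (abs_le.1 hd).1, hd'⟩)
  constructor <;> linarith

theorem AbsolutelyContinuousOnInterval.eval {n : ℕ} {x : ℝ → Fin n → ℝ} {a b : ℝ}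
    (hx : AbsolutelyContinuousOnInterval x a b) (i : Fin n) :
    AbsolutelyContinuousOnInterval (fun t => x t i) a b := by
  refine squeeze_zero (fun t => ?_) (fun t => ?_) hx
  · exact Finset.sum_nonneg fun i _ => dist_nonneg
  · exact Finset.sum_le_sum fun k _ => dist_le_pi_dist _ _ i

/-! ### The Filippov map of a monotone function. -/

/-- `v` lies between the one-sided limits at `s` of the monotone function `f`. -/
def IsBetween (f : ℝ → ℝ) (s v : ℝ) : Prop :=
  (∀ r < s, f r ≤ v) ∧ ∀ r > s, v ≤ f r

theorem IsBetween.neg {f : ℝ → ℝ} {s v : ℝ} (h : IsBetween f s v) :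
    IsBetween (fun r => -f (-r)) (-s) (-v) :=
  ⟨fun r hr => neg_le_neg (h.2 (-r) (by linarith)), fun r hr => neg_le_neg (h.1 (-r) (by linarith))⟩

theorem IsBetween.le {f : ℝ → ℝ} {s t v w : ℝ} (hv : IsBetween f s v) (hw : IsBetween f t w)
    (h : s < t) : v ≤ w :=
  (hv.2 ((s + t) / 2) (by linarith)).trans (hw.1 _ (by linarith))

theorem IsBetween.abs_le {f : ℝ → ℝ} {s v B : ℝ} (hv : IsBetween f s v)
    (hs : |s| ≤ B) : |v| ≤ max |f (B + 1)| |f (-B - 1)| := by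
  obtain ⟨h1, h2⟩ := _root_.abs_le.1 hs
  exact (abs_le_max_abs_abs (hv.1 (-B - 1) (by linarith)) (hv.2 (B + 1) (by linarith))).trans
    (max_comm _ _).le

theorem exists_mem_Ioo_notMem_of_volume_eq_zero {a b : ℝ} (hab : a < b) {S : Set ℝ}
    (hS : volume S = 0) : ∃ r ∈ Ioo a b, r ∉ S := by
  by_contra! h
  have : volume (Ioo a b) ≤ volume S := measure_mono h
  rw [hS, Real.volume_Ioo] at this
  simp at this
  linarith

/-- A null set cannot cover an interval, so after its removal points remain arbitrarily close to `s`
on both sides, and their values enclose `v`. Conversely, a small ball with nothing removed already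
gives each one-sided bound. -/
theorem Monotone.mem_filippov_iff {f : ℝ → ℝ} (hf : Monotone f) {s v : ℝ} :
    v ∈ filippov f s ↔ IsBetween f s v := by
  simp only [filippov, mem_iInter]
  constructor
  · intro h
    constructor
    · intro r hr
      have h1 := h (s - r) (by linarith) ∅ (by simp)
      refine closure_minimal (convexHull_min ?_ (convex_Ici (f r))) isClosed_Ici h1
      rintro _ ⟨q, ⟨hq, -⟩, rfl⟩
      rw [Real.ball_eq_Ioo] at hq
      exact hf (by linarith [hq.1])
    · intro r hr
      have h1 := h (r - s) (by linarith) ∅ (by simp)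
      refine closure_minimal (convexHull_min ?_ (convex_Iic (f r))) isClosed_Iic h1
      rintro _ ⟨q, ⟨hq, -⟩, rfl⟩
      rw [Real.ball_eq_Ioo] at hq
      exact hf (by linarith [hq.2])
  · intro h δ hδ S hS
    obtain ⟨p, hp, hpS⟩ := exists_mem_Ioo_notMem_of_volume_eq_zero (sub_lt_self s hδ) hS
    obtain ⟨q, hq, hqS⟩ := exists_mem_Ioo_notMem_of_volume_eq_zero (lt_add_of_pos_right s hδ) hS
    refine subset_closure ?_
    have hpm : f p ∈ convexHull ℝ (f '' (Metric.ball s δ \ S)) :=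
      subset_convexHull _ _ ⟨p, ⟨by rw [Real.ball_eq_Ioo]; exact ⟨hp.1, by linarith [hp.2]⟩, hpS⟩, rfl⟩
    have hqm : f q ∈ convexHull ℝ (f '' (Metric.ball s δ \ S)) :=
      subset_convexHull _ _ ⟨q, ⟨by rw [Real.ball_eq_Ioo]; exact ⟨by linarith [hq.1], hq.2⟩, hqS⟩, rfl⟩
    exact (convex_convexHull ℝ _).ordConnected.out hpm hqm ⟨h.1 p hp.2, h.2 q hq.1⟩

/-! ### Trajectories and the maximum principle. -/

/-- On `[a, b]`, `x` is a Lipschitz solution of `xᵢ' = ∑ⱼ Aᵢⱼ (νⱼ - νᵢ)`, where `νᵢ` lies between the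
one-sided limits of `f` at `xᵢ`. -/
structure IsTrajectory {n : ℕ} (A : Matrix (Fin n) (Fin n) ℝ) (f : ℝ → ℝ) (a b : ℝ)
    (x : ℝ → Fin n → ℝ) : Prop where
  lipschitz : ∃ K, ∀ s ∈ Icc a b, ∀ t ∈ Icc a b, ∀ i, |x s i - x t i| ≤ K * |s - t|
  inclusion : ∀ᵐ t, t ∈ Ioo a b → ∃ ν : Fin n → ℝ, (∀ i, IsBetween f (x t i) (ν i)) ∧
    ∀ i, HasDerivAt (fun s => x s i) (∑ j, A i j * (ν j - ν i)) t

namespace IsTrajectory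

variable {n : ℕ} {A : Matrix (Fin n) (Fin n) ℝ} {f : ℝ → ℝ} {a b : ℝ} {x : ℝ → Fin n → ℝ}

theorem mono (hx : IsTrajectory A f a b x) {a' b' : ℝ} (ha : a ≤ a') (hb : b' ≤ b) :
    IsTrajectory A f a' b' x := by
  obtain ⟨K, hK⟩ := hx.lipschitz
  refine ⟨⟨K, fun s hs t ht => hK s (Icc_subset_Icc ha hb hs) t (Icc_subset_Icc ha hb ht)⟩, ?_⟩
  filter_upwards [hx.inclusion] with t ht htI using ht (Ioo_subset_Ioo ha hb htI)

/-- This symmetry turns every statement about maxima into one about minima. -/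
theorem neg (hx : IsTrajectory A f a b x) :
    IsTrajectory A (fun r => -f (-r)) a b (fun t i => -x t i) := by
  obtain ⟨K, hK⟩ := hx.lipschitz
  refine ⟨⟨K, fun s hs t ht i => ?_⟩, ?_⟩
  · have := hK s hs t ht i
    rwa [← abs_neg, show -(-x s i - -x t i) = x s i - x t i by ring]
  · filter_upwards [hx.inclusion] with t ht htI
    obtain ⟨ν, h1, h2⟩ := ht htI
    refine ⟨fun i => -ν i, fun i => (h1 i).neg, fun i => ?_⟩
    convert! (h2 i).neg using 1
    rw [← Finset.sum_neg_distrib]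
    exact Finset.sum_congr rfl fun j _ => by ring

end IsTrajectory

theorem absolutelyContinuousOnInterval_of_abs_sub_le {u : ℝ → ℝ} {a b K : ℝ}
    (hab : a ≤ b) (h : ∀ s ∈ Icc a b, ∀ t ∈ Icc a b, |u s - u t| ≤ K * |s - t|) :
    AbsolutelyContinuousOnInterval u a b := by
  refine LipschitzOnWith.absolutelyContinuousOnInterval (K := K.toNNReal) ?_
  rw [uIcc_of_le hab]
  refine LipschitzOnWith.of_dist_le_mul fun s hs t ht => ?_
  rw [Real.dist_eq, Real.dist_eq]
  exact (h s hs t ht).trans (mul_le_mul_of_nonneg_right (Real.le_coe_toNNReal K) (abs_nonneg _))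

/-- If `u ≤ v` with equality at `t`, then `u` and `v` have the same derivative at `t`. -/
theorem HasDerivAt.eq_of_le_of_eq {u v : ℝ → ℝ} {t d e : ℝ} (hu : HasDerivAt u d t)
    (hv : HasDerivAt v e t) (hle : ∀ᶠ s in 𝓝 t, u s ≤ v s) (heq : u t = v t) : d = e := by
  have : IsLocalMin (fun s => v s - u s) t := by
    filter_upwards [hle] with s hs
    simp only [heq, sub_self]
    linarith
  have := this.hasDerivAt_eq_zero (hv.sub hu)
  linarith

theorem abs_sup'_sub_sup'_le {ι : Type*} {W : Finset ι} (hW : W.Nonempty) {u v : ι → ℝ} {c : ℝ}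
    (h : ∀ i, |u i - v i| ≤ c) : |W.sup' hW u - W.sup' hW v| ≤ c := by
  rw [abs_le]
  have h1 : W.sup' hW u ≤ W.sup' hW v + c := Finset.sup'_le _ _ fun i hi => by
    linarith [(abs_le.1 (h i)).2, Finset.le_sup' v hi]
  have h2 : W.sup' hW v ≤ W.sup' hW u + c := Finset.sup'_le _ _ fun i hi => by
    linarith [(abs_le.1 (h i)).1, Finset.le_sup' u hi]
  constructor <;> linarith

/-- The maximum over a set of nodes without incoming edges does not increase. -/
theorem IsTrajectory.sup'_le {n : ℕ} {A : Matrix (Fin n) (Fin n) ℝ} (hA : ∀ i j, 0 ≤ A i j)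
    {f : ℝ → ℝ} {a b : ℝ} {x : ℝ → Fin n → ℝ} (hx : IsTrajectory A f a b x) (hab : a ≤ b)
    {W : Finset (Fin n)} (hW : W.Nonempty) (hWA : ∀ i ∈ W, ∀ j, 0 < A i j → j ∈ W) :
    W.sup' hW (x b) ≤ W.sup' hW (x a) := by
  obtain ⟨K, hK⟩ := hx.lipschitz
  have hac : AbsolutelyContinuousOnInterval (fun t => W.sup' hW (x t)) a b :=
    absolutelyContinuousOnInterval_of_abs_sub_le (K := K) hab fun s hs t ht =>
      abs_sup'_sub_sup'_le hW (hK s hs t ht)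
  have := hac.sub_le_of_ae_hasDerivAt_le (C := 0) hab (by
    filter_upwards [hx.inclusion, hac.ae_differentiableAt] with t ht htd htI
    obtain ⟨ν, hν, hd⟩ := ht htI
    have htd := htd (by rw [uIcc_of_le hab]; exact Ioo_subset_Icc_self htI)
    refine ⟨_, ?_, htd.hasDerivAt⟩
    obtain ⟨i₀, hi₀, hi₀m⟩ := W.exists_mem_eq_sup' hW (x t)
    -- Break ties among the maximizers by the largest `ν`: in-neighbours at the maximum then have
    -- smaller or equal `ν` by choice, those below it by monotonicity.
    obtain ⟨i, hi, him⟩ := (W.filter fun i => x t i = W.sup' hW (x t)).exists_max_image ν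
      ⟨i₀, by simp [hi₀, hi₀m]⟩
    rw [Finset.mem_filter] at hi
    rw [← (hd i).eq_of_le_of_eq htd.hasDerivAt
      (Eventually.of_forall fun s => Finset.le_sup' (x s) hi.1) hi.2]
    refine Finset.sum_nonpos fun j _ => ?_
    rcases (hA i j).eq_or_lt with h0 | h0
    · simp [← h0]
    refine mul_nonpos_of_nonneg_of_nonpos h0.le (sub_nonpos.2 ?_)
    have hj := hWA i hi.1 j h0
    rcases (Finset.le_sup' (x t) hj).eq_or_lt with h | h
    · exact him j (by simp [hj, h])
    · exact (hν j).le (hν i) (hi.2 ▸ h))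
  linarith

theorem IsTrajectory.le_of_forall_le {n : ℕ} {A : Matrix (Fin n) (Fin n) ℝ} (hA : ∀ i j, 0 ≤ A i j)
    {f : ℝ → ℝ} {a b : ℝ} {x : ℝ → Fin n → ℝ} (hx : IsTrajectory A f a b x) (hab : a ≤ b)
    {W : Finset (Fin n)} (hWA : ∀ i ∈ W, ∀ j, 0 < A i j → j ∈ W) {B : ℝ}
    (hB : ∀ i ∈ W, x a i ≤ B) : ∀ i ∈ W, x b i ≤ B := fun i hi =>
  (Finset.le_sup' (x b) hi).trans <| (hx.sup'_le hA hab ⟨i, hi⟩ hWA).trans <|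
    Finset.sup'_le _ _ hB

theorem IsTrajectory.le_of_forall_ge {n : ℕ} {A : Matrix (Fin n) (Fin n) ℝ} (hA : ∀ i j, 0 ≤ A i j)
    {f : ℝ → ℝ} {a b : ℝ} {x : ℝ → Fin n → ℝ} (hx : IsTrajectory A f a b x) (hab : a ≤ b)
    {W : Finset (Fin n)} (hWA : ∀ i ∈ W, ∀ j, 0 < A i j → j ∈ W) {B : ℝ}
    (hB : ∀ i ∈ W, B ≤ x a i) : ∀ i ∈ W, B ≤ x b i := fun i hi => by
  have := hx.neg.le_of_forall_le hA hab hWA (B := -B) (fun i hi => neg_le_neg (hB i hi)) i hi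
  linarith

/-! ### Limits of discrete schemes. -/

theorem natFloor_sub_natFloor_le {a b : ℝ} (hab : a ≤ b) : (⌊b⌋₊ : ℝ) - ⌊a⌋₊ ≤ b - a + 1 := by
  have h1 := Nat.sub_one_lt_floor a
  rcases le_or_gt 0 b with hb | hb
  · linarith [Nat.floor_le hb]
  · rw [Nat.floor_of_nonpos hb.le]
    have : (0 : ℝ) ≤ ⌊a⌋₊ := Nat.cast_nonneg _
    push_cast
    linarith

theorem tendsto_mul_natFloor_div {l : Filter ℕ} {h : ℕ → ℝ} (hh : ∀ k, 0 < h k)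
    (hh0 : Tendsto h l (𝓝 0)) {t : ℝ} (ht : 0 ≤ t) :
    Tendsto (fun k => h k * ⌊t / h k⌋₊) l (𝓝 t) := by
  have h1 : Tendsto (fun k => t - h k) l (𝓝 t) := by simpa using hh0.const_sub t
  refine tendsto_of_tendsto_of_tendsto_of_le_of_le h1 tendsto_const_nhds (fun k => ?_) fun k => ?_
  · have := mul_le_mul_of_nonneg_left (Nat.sub_one_lt_floor (t / h k)).le (hh k).le
    have h2 : h k * (t / h k - 1) = t - h k := by field_simp [(hh k).ne']
    linarith
  · have := mul_le_mul_of_nonneg_left (Nat.floor_le (div_nonneg ht (hh k).le)) (hh k).le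
    have h2 : h k * (t / h k) = t := by field_simp [(hh k).ne']
    linarith

/-- The derivative of a limit of Riemann sums of `ν k`, where `ν k` is at most `f` near `X k`, is at
most the value of `f` on the right of the limit of `X k`. -/
theorem HasDerivAt.le_of_tendsto_sum {l : Filter ℕ} [l.NeBot] {f : ℝ → ℝ} (hf : Monotone f)
    {h δ : ℕ → ℝ} (hh : ∀ k, 0 < h k) (hh0 : Tendsto h l (𝓝 0)) (hδ : Tendsto δ l (𝓝 0))
    {X ν : ℕ → ℕ → ℝ} {D : ℝ} (hX : ∀ k m, |X k (m + 1) - X k m| ≤ D * h k)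
    (hν : ∀ k m, ν k m ≤ f (X k m + δ k)) {t y s p : ℝ} {N : ℝ → ℝ} (ht : 0 ≤ t)
    (hy : Tendsto (fun k => X k ⌊t / h k⌋₊) l (𝓝 y))
    (hN : ∀ τ, Tendsto (fun k => h k * ∑ q ∈ Finset.range ⌊τ / h k⌋₊, ν k q) l (𝓝 (N τ)))
    (hp : HasDerivAt N p t) (hs : y < s) : p ≤ f s := by
  have hD : 0 ≤ D := by
    by_contra! hD
    have := (abs_nonneg _).trans (hX 0 0)
    nlinarith [hh 0]
  have key : ∀ᶠ τ in 𝓝[>] (0 : ℝ), N (t + τ) - N t ≤ τ * f s := by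
    -- The gap from `y` to `s` is shared by four errors: convergence of the starting point, drift
    -- during time `τ`, drift during one extra step due to rounding, and `δ k`.
    have hη : 0 < (s - y) / 4 := by linarith
    filter_upwards [Ioo_mem_nhdsGT (show 0 < (s - y) / 4 / (D + 1) by positivity)] with τ hτ
    have hτD : D * τ ≤ (s - y) / 4 := by
      have := (lt_div_iff₀ (by linarith)).1 hτ.2
      nlinarith [hτ.1]
    have hlim : Tendsto (fun k => (h k * ⌊(t + τ) / h k⌋₊ - h k * ⌊t / h k⌋₊) * f s) l
        (𝓝 ((t + τ - t) * f s)) :=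
      ((tendsto_mul_natFloor_div hh hh0 (by linarith [hτ.1])).sub
        (tendsto_mul_natFloor_div hh hh0 ht)).mul_const _
    rw [add_sub_cancel_left] at hlim
    refine le_of_tendsto_of_tendsto ((hN (t + τ)).sub (hN t)) hlim ?_
    have hDh : Tendsto (fun k => D * h k) l (𝓝 0) := by simpa using hh0.const_mul D
    filter_upwards [hy.eventually_lt_const (show y < y + (s - y) / 4 by linarith),
      hδ.eventually_lt_const hη, hDh.eventually_lt_const hη] with k h1 h2 h3
    have hmm : ⌊t / h k⌋₊ ≤ ⌊(t + τ) / h k⌋₊ :=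
      Nat.floor_mono ((div_le_div_iff_of_pos_right (hh k)).2 (by linarith [hτ.1]))
    have hwidth : h k * ((⌊(t + τ) / h k⌋₊ : ℝ) - ⌊t / h k⌋₊) ≤ τ + h k := by
      have := mul_le_mul_of_nonneg_left (natFloor_sub_natFloor_le
        ((div_le_div_iff_of_pos_right (hh k)).2 (show t ≤ t + τ by linarith [hτ.1]))) (hh k).le
      have h4 : h k * ((t + τ) / h k - t / h k + 1) = τ + h k := by
        field_simp [(hh k).ne']; ring
      linarith
    rw [← mul_sub, ← mul_sub, ← Finset.sum_Ico_eq_sub _ hmm, mul_assoc]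
    refine mul_le_mul_of_nonneg_left ?_ (hh k).le
    have hdrift : ∀ q, X k (⌊t / h k⌋₊ + q) ≤ X k ⌊t / h k⌋₊ + D * (h k * q) := by
      intro q
      induction q with
      | zero => simp
      | succ q ih =>
        have := (abs_le.1 (hX k (⌊t / h k⌋₊ + q))).2
        rw [← add_assoc]
        push_cast
        linarith
    have hle : ∀ q ∈ Finset.Ico ⌊t / h k⌋₊ ⌊(t + τ) / h k⌋₊, ν k q ≤ f s := by
      intro q hq
      rw [Finset.mem_Ico] at hq
      obtain ⟨r, rfl⟩ := Nat.exists_eq_add_of_le hq.1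
      have hr : (r : ℝ) ≤ (⌊(t + τ) / h k⌋₊ : ℝ) - ⌊t / h k⌋₊ := by
        have : ((⌊t / h k⌋₊ + r : ℕ) : ℝ) ≤ ⌊(t + τ) / h k⌋₊ := by exact_mod_cast hq.2.le
        push_cast at this
        linarith
      refine (hν k _).trans (hf ?_)
      have h5 : D * (h k * r) ≤ D * (τ + h k) := mul_le_mul_of_nonneg_left
        ((mul_le_mul_of_nonneg_left hr (hh k).le).trans hwidth) hD
      have := hdrift r
      linarith
    refine (Finset.sum_le_card_nsmul _ _ _ hle).trans (le_of_eq ?_)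
    rw [Nat.card_Ico, nsmul_eq_mul, Nat.cast_sub hmm]
  have hslope := hp.tendsto_slope_zero_right
  refine le_of_tendsto hslope ?_
  filter_upwards [key, self_mem_nhdsWithin] with τ hτ hτ0
  rw [smul_eq_mul, inv_mul_le_iff₀ hτ0]
  linarith

/-- `N` is an integrated selection of the Filippov map along the solution `y = y 0 - L N` of
`y' ∈ -L F[f](y)` on `[0, ∞)`. -/
structure IsFlow {n : ℕ} (A : Matrix (Fin n) (Fin n) ℝ) (f : ℝ → ℝ) (y N : ℝ → Fin n → ℝ) :
    Prop where
  lipschitz : ∃ K, ∀ s t i, |N s i - N t i| ≤ K * |s - t|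
  eq : ∀ t i, y t i = y 0 i + ∑ j, A i j * (N t j - N t i)
  isBetween : ∀ t, 0 < t → ∀ i p, HasDerivAt (fun s => N s i) p t → IsBetween f (y t i) p

theorem Ultrafilter.exists_tendsto_of_abs_le (U : Ultrafilter ℕ) {u : ℕ → ℝ} {B : ℝ}
    (hu : ∀ᶠ k in (U : Filter ℕ), |u k| ≤ B) : ∃ c, Tendsto u U (𝓝 c) := by
  obtain ⟨c, -, hc⟩ := (isCompact_Icc (a := -B) (b := B)).ultrafilter_le_nhds (U.map u) (by
    rw [le_principal_iff, Ultrafilter.coe_map, Filter.mem_map]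
    filter_upwards [hu] with k hk using abs_le.1 hk)
  exact ⟨c, hc⟩

/-- Serves both Euler schemes and sampled translates of a solution. The state is affine in the
Riemann sums of `ν`, which are bounded at each time; an ultrafilter makes them converge at all times
at once, with no choice of subsequence. The limit sums are Lipschitz since each `ν` is bounded by
`C`. -/
theorem exists_isFlow_of_discrete {n : ℕ} (A : Matrix (Fin n) (Fin n) ℝ) {f : ℝ → ℝ}
    (hf : Monotone f) (U : Ultrafilter ℕ) {h δ : ℕ → ℝ} (hh : ∀ k, 0 < h k)
    (hh0 : Tendsto h U (𝓝 0)) (hδ : Tendsto δ U (𝓝 0)) {X ν : ℕ → ℕ → Fin n → ℝ} {B C : ℝ}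
    (hX : ∀ k m i, X k (m + 1) i = X k m i + h k * ∑ j, A i j * (ν k m j - ν k m i))
    (hν₁ : ∀ k m i, f (X k m i - δ k) ≤ ν k m i) (hν₂ : ∀ k m i, ν k m i ≤ f (X k m i + δ k))
    (hB : ∀ k i, |X k 0 i| ≤ B) (hC : ∀ k m i, |ν k m i| ≤ C) :
    ∃ y N, IsFlow A f y N ∧ ∀ t i, Tendsto (fun k => X k ⌊t / h k⌋₊ i) U (𝓝 (y t i)) := by
  set S : ℕ → ℕ → Fin n → ℝ := fun k m i => h k * ∑ q ∈ Finset.range m, ν k q i with hS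
  have hXS : ∀ k m i, X k m i = X k 0 i + ∑ j, A i j * (S k m j - S k m i) := by
    intro k m i
    induction m with
    | zero => simp [hS]
    | succ m ih =>
      rw [hX, ih, add_assoc, Finset.mul_sum, ← Finset.sum_add_distrib]
      congr 1
      refine Finset.sum_congr rfl fun j _ => ?_
      simp only [hS, Finset.sum_range_succ]
      ring
  have hSinc : ∀ k i s t, s ≤ t →
      |S k ⌊t / h k⌋₊ i - S k ⌊s / h k⌋₊ i| ≤ C * (t - s + h k) := by
    intro k i s t hst
    have hst' : s / h k ≤ t / h k := (div_le_div_iff_of_pos_right (hh k)).2 hst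
    have hmm := Nat.floor_mono hst'
    have hC0 : 0 ≤ C := (abs_nonneg _).trans (hC k 0 i)
    simp only [hS]
    rw [← mul_sub, ← Finset.sum_Ico_eq_sub _ hmm, abs_mul, abs_of_pos (hh k)]
    have h1 : |∑ q ∈ Finset.Ico ⌊s / h k⌋₊ ⌊t / h k⌋₊, ν k q i| ≤
        ((⌊t / h k⌋₊ : ℝ) - ⌊s / h k⌋₊) * C := by
      refine (Finset.abs_sum_le_sum_abs _ _).trans
        ((Finset.sum_le_card_nsmul _ _ C fun q _ => hC k q i).trans (le_of_eq ?_))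
      rw [Nat.card_Ico, nsmul_eq_mul, Nat.cast_sub hmm]
    have h2 := natFloor_sub_natFloor_le hst'
    calc h k * |∑ q ∈ Finset.Ico ⌊s / h k⌋₊ ⌊t / h k⌋₊, ν k q i|
        ≤ h k * ((t / h k - s / h k + 1) * C) := mul_le_mul_of_nonneg_left
          (h1.trans (mul_le_mul_of_nonneg_right h2 hC0)) (hh k).le
      _ = C * (t - s + h k) := by field_simp [(hh k).ne']
  have hlim : ∀ t i, ∃ c, Tendsto (fun k => S k ⌊t / h k⌋₊ i) U (𝓝 c) := by
    intro t i
    have hC0 : 0 ≤ C := (abs_nonneg _).trans (hC 0 0 i)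
    refine U.exists_tendsto_of_abs_le (B := C * (|t| + 1)) ?_
    filter_upwards [hh0.eventually_lt_const one_pos] with k hk
    rcases le_total 0 t with ht | ht
    · have := hSinc k i 0 t ht
      simp only [zero_div, Nat.floor_zero, sub_zero] at this
      rw [show S k 0 i = 0 by simp [hS], sub_zero] at this
      refine this.trans (mul_le_mul_of_nonneg_left ?_ hC0)
      rw [abs_of_nonneg ht]
      linarith
    · rw [Nat.floor_of_nonpos (div_nonpos_of_nonpos_of_nonneg ht (hh k).le),
        show S k 0 i = 0 by simp [hS], abs_zero]
      positivity
  choose N hN using hlim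
  have hlim0 : ∀ i, ∃ c, Tendsto (fun k => X k 0 i) U (𝓝 c) := fun i =>
    U.exists_tendsto_of_abs_le (Eventually.of_forall fun k => hB k i)
  choose y₀ hy₀ using hlim0
  have hN0 : ∀ i, N 0 i = 0 := fun i => by
    refine tendsto_nhds_unique (hN 0 i) ?_
    simp [hS]
  have hy : ∀ t i, Tendsto (fun k => X k ⌊t / h k⌋₊ i) U
      (𝓝 (y₀ i + ∑ j, A i j * (N t j - N t i))) := by
    intro t i
    rw [funext fun k => hXS k ⌊t / h k⌋₊ i]
    refine (hy₀ i).add (tendsto_finsetSum _ fun j _ => ?_)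
    exact ((hN t j).sub (hN t i)).const_mul _
  have hlip1 : ∀ i s t, s ≤ t → |N t i - N s i| ≤ C * (t - s) := by
    intro i s t hst
    have h1 : Tendsto (fun k => C * (t - s + h k)) U (𝓝 (C * (t - s))) := by
      simpa using (hh0.const_add (t - s)).const_mul C
    exact le_of_tendsto_of_tendsto ((hN t i).sub (hN s i)).abs h1
      (Eventually.of_forall fun k => hSinc k i s t hst)
  have hstep : ∀ i k m, |X k (m + 1) i - X k m i| ≤ (∑ j, |A i j| * (2 * C)) * h k := by
    intro i k m
    rw [hX, add_sub_cancel_left, abs_mul, abs_of_pos (hh k), mul_comm]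
    refine mul_le_mul_of_nonneg_right ((Finset.abs_sum_le_sum_abs _ _).trans
      (Finset.sum_le_sum fun j _ => ?_)) (hh k).le
    rw [abs_mul]
    refine mul_le_mul_of_nonneg_left ?_ (abs_nonneg _)
    have := abs_sub (ν k m j) (ν k m i)
    linarith [hC k m i, hC k m j]
  refine ⟨fun t i => y₀ i + ∑ j, A i j * (N t j - N t i), N, ⟨⟨C, fun s t i => ?_⟩, fun t i => ?_,
    fun t ht i p hp => ⟨fun r hr => ?_, fun r hr => ?_⟩⟩, hy⟩
  · rcases le_total s t with hst | hst
    · rw [abs_sub_comm, abs_sub_comm s, abs_of_nonneg (sub_nonneg.2 hst)]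
      exact hlip1 i s t hst
    · rw [abs_of_nonneg (sub_nonneg.2 hst)]
      exact hlip1 i t s hst
  · simp [hN0]
  -- The lower bound is the upper bound for the reflected scheme.
  · have := HasDerivAt.le_of_tendsto_sum (l := U) (f := fun r => -f (-r)) (p := -p) (s := -r)
      (X := fun k m => -X k m i) (ν := fun k m => -ν k m i) (N := fun s => -N s i) (t := t)
      (D := ∑ j, |A i j| * (2 * C)) (fun a b hab => neg_le_neg (hf (neg_le_neg hab))) hh hh0 hδ
      (fun k m => by
        rw [← abs_neg, show -(-X k (m + 1) i - -X k m i) = X k (m + 1) i - X k m i by ring]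
        exact hstep i k m)
      (fun k m => by
        rw [neg_add, neg_neg, ← sub_eq_add_neg]
        exact neg_le_neg (hν₁ k m i))
      ht.le (hy t i).neg (fun τ => by simpa [hS, Finset.sum_neg_distrib] using (hN τ i).neg) hp.neg
      (neg_lt_neg hr)
    simpa using this
  · exact HasDerivAt.le_of_tendsto_sum (l := U) (X := fun k m => X k m i)
      (ν := fun k m => ν k m i) (N := fun s => N s i) hf hh hh0 hδ (hstep i) (fun k m => hν₂ k m i)
      ht.le (hy t i) (fun τ => hN τ i) hp hr

/-! ### Solutions as trajectories, with uniform bounds. -/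

theorem WeightedDigraph.neg_laplacian_mulVec {n : ℕ} (G : WeightedDigraph n) (ν : Fin n → ℝ)
    (i : Fin n) : (-(G.laplacian.mulVec ν)) i = ∑ j, G.A i j * (ν j - ν i) := by
  rw [laplacian, Matrix.sub_mulVec, Pi.neg_apply, Pi.sub_apply, Matrix.mulVec_diagonal, inDegree,
    neg_sub, Matrix.mulVec, dotProduct, Finset.sum_mul, ← Finset.sum_sub_distrib]
  exact Finset.sum_congr rfl fun j _ => by ring

theorem mem_consensusMap_iff {n : ℕ} {G : WeightedDigraph n} {f : ℝ → ℝ} (hf : Monotone f)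
    {x v : Fin n → ℝ} : v ∈ consensusMap G (fun _ => f) x ↔ ∃ ν : Fin n → ℝ,
      (∀ i, IsBetween f (x i) (ν i)) ∧ v = fun i => ∑ j, G.A i j * (ν j - ν i) := by
  simp only [consensusMap, mem_image, mem_univ_pi, hf.mem_filippov_iff]
  refine exists_congr fun ν => and_congr_right fun _ => ?_
  rw [eq_comm, show -(G.laplacian.mulVec ν) = fun i => ∑ j, G.A i j * (ν j - ν i) from
    funext (G.neg_laplacian_mulVec ν)]

/-- A bound for the speed `|∑ⱼ Aᵢⱼ (νⱼ - νᵢ)|` when all `|νⱼ| ≤ C`. -/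
def speedBound {n : ℕ} (A : Matrix (Fin n) (Fin n) ℝ) (C : ℝ) : ℝ :=
  ∑ i, ∑ j, |A i j| * (2 * |C|)

theorem speedBound_nonneg {n : ℕ} (A : Matrix (Fin n) (Fin n) ℝ) (C : ℝ) : 0 ≤ speedBound A C :=
  Finset.sum_nonneg fun _ _ => Finset.sum_nonneg fun _ _ => by positivity

theorem abs_sum_mul_sub_le_speedBound {n : ℕ} (A : Matrix (Fin n) (Fin n) ℝ) {C : ℝ}
    {ν : Fin n → ℝ} (hν : ∀ i, |ν i| ≤ C) (i : Fin n) :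
    |∑ j, A i j * (ν j - ν i)| ≤ speedBound A C := by
  refine le_trans ?_ (Finset.single_le_sum (f := fun i => ∑ j, |A i j| * (2 * |C|))
    (fun _ _ => Finset.sum_nonneg fun _ _ => by positivity) (Finset.mem_univ i))
  refine (Finset.abs_sum_le_sum_abs _ _).trans (Finset.sum_le_sum fun j _ => ?_)
  rw [abs_mul]
  refine mul_le_mul_of_nonneg_left ?_ (abs_nonneg _)
  linarith [abs_sub (ν j) (ν i), hν i, hν j, le_abs_self C]

/-- A bound on the states bounds the selected values and hence the speed. The constant does not
depend on the time interval, as extension and translation require. -/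
theorem abs_sub_le_of_inclusion {n : ℕ} {A : Matrix (Fin n) (Fin n) ℝ} {f : ℝ → ℝ} {a b B : ℝ}
    {x : ℝ → Fin n → ℝ} (hac : ∀ i, AbsolutelyContinuousOnInterval (fun t => x t i) a b)
    (hx : ∀ᵐ t, t ∈ Ioo a b → ∃ ν : Fin n → ℝ, (∀ i, IsBetween f (x t i) (ν i)) ∧
      ∀ i, HasDerivAt (fun s => x s i) (∑ j, A i j * (ν j - ν i)) t)
    (hB : ∀ t ∈ Icc a b, ∀ i, |x t i| ≤ B) :
    ∀ s ∈ Icc a b, ∀ t ∈ Icc a b, ∀ i,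
      |x s i - x t i| ≤ speedBound A (max |f (B + 1)| |f (-B - 1)|) * |s - t| := by
  have key : ∀ s ∈ Icc a b, ∀ t ∈ Icc a b, s ≤ t → ∀ i,
      |x t i - x s i| ≤ speedBound A (max |f (B + 1)| |f (-B - 1)|) * (t - s) := by
    intro s hs t ht hst i
    have hab : a ≤ b := hs.1.trans hs.2
    have hac' : AbsolutelyContinuousOnInterval (fun t => x t i) s t :=
      (hac i).mono (by rw [uIcc_of_le hst, uIcc_of_le hab]; exact Icc_subset_Icc hs.1 ht.2)
    refine hac'.abs_sub_le_of_ae_hasDerivAt hst ?_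
    filter_upwards [hx] with τ hτ hτI
    have hτI' : τ ∈ Ioo a b := Ioo_subset_Ioo hs.1 ht.2 hτI
    obtain ⟨ν, h1, h2⟩ := hτ hτI'
    exact ⟨_, abs_sum_mul_sub_le_speedBound A
      (fun i => (h1 i).abs_le (hB τ (Ioo_subset_Icc_self hτI') i)) i, h2 i⟩
  intro s hs t ht i
  rcases le_total s t with hst | hst
  · rw [abs_sub_comm, abs_sub_comm s, abs_of_nonneg (sub_nonneg.2 hst)]
    exact key s hs t ht hst i
  · rw [abs_of_nonneg (sub_nonneg.2 hst)]
    exact key t ht s hs hst i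

theorem IsTrajectory.abs_sub_le {n : ℕ} {A : Matrix (Fin n) (Fin n) ℝ} {f : ℝ → ℝ} {a b B : ℝ}
    {x : ℝ → Fin n → ℝ} (hx : IsTrajectory A f a b x) (hB : ∀ t ∈ Icc a b, ∀ i, |x t i| ≤ B) :
    ∀ s ∈ Icc a b, ∀ t ∈ Icc a b, ∀ i,
      |x s i - x t i| ≤ speedBound A (max |f (B + 1)| |f (-B - 1)|) * |s - t| := by
  intro s hs t ht
  obtain ⟨K, hK⟩ := hx.lipschitz
  exact abs_sub_le_of_inclusion (fun i => absolutelyContinuousOnInterval_of_abs_sub_le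
    (hs.1.trans hs.2) fun s hs t ht => hK s hs t ht i) hx.inclusion hB s hs t ht

theorem IsSolution.Icc_subset {n : ℕ} {K : (Fin n → ℝ) → Set (Fin n → ℝ)} {I : Set ℝ}
    {x : ℝ → Fin n → ℝ} (hx : IsSolution K I x) {T : ℝ} (hT : T ∈ I) : Icc 0 T ⊆ I :=
  hx.ordConnected.out hx.zero_mem hT

theorem IsSolution.isTrajectory {n : ℕ} {G : WeightedDigraph n} {f : ℝ → ℝ} (hf : Monotone f)
    {I : Set ℝ} {x : ℝ → Fin n → ℝ} (hx : IsSolution (consensusMap G fun _ => f) I x) {T : ℝ}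
    (hT : T ∈ I) : IsTrajectory G.A f 0 T x := by
  have hinc : ∀ᵐ t, t ∈ Ioo 0 T → ∃ ν : Fin n → ℝ, (∀ i, IsBetween f (x t i) (ν i)) ∧
      ∀ i, HasDerivAt (fun s => x s i) (∑ j, G.A i j * (ν j - ν i)) t := by
    filter_upwards [hx.inclusion] with t ht htI
    have hI := hx.Icc_subset hT
    obtain ⟨v, hv, hd⟩ := ht (hI (Ioo_subset_Icc_self htI))
    obtain ⟨ν, h1, rfl⟩ := (mem_consensusMap_iff hf).1 hv
    have hd' := hd.hasDerivAt (mem_of_superset (Icc_mem_nhds htI.1 htI.2) hI)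
    exact ⟨ν, h1, hasDerivAt_pi.1 hd'⟩
  have hac := hx.absolutelyContinuous T hT
  obtain ⟨B, hB⟩ := hac.exists_bound
  rw [uIcc_of_le (hx.nonneg T hT)] at hB
  exact ⟨⟨_, abs_sub_le_of_inclusion hac.eval hinc fun t ht i =>
    (norm_le_pi_norm (x t) i).trans (hB t ht)⟩, hinc⟩

theorem IsSolution.abs_le {n : ℕ} {G : WeightedDigraph n} {f : ℝ → ℝ} (hf : Monotone f)
    {I : Set ℝ} {x : ℝ → Fin n → ℝ} (hx : IsSolution (consensusMap G fun _ => f) I x) {t : ℝ}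
    (ht : t ∈ I) (i : Fin n) : |x t i| ≤ ‖x 0‖ := by
  have h := hx.isTrajectory hf ht
  have h0 := hx.nonneg t ht
  have hb : ∀ i ∈ Finset.univ, |x 0 i| ≤ ‖x 0‖ := fun i _ => norm_le_pi_norm (x 0) i
  exact _root_.abs_le.2 ⟨h.le_of_forall_ge G.nonneg h0 (by simp)
      (fun i hi => (_root_.abs_le.1 (hb i hi)).1) i (Finset.mem_univ i),
    h.le_of_forall_le G.nonneg h0 (by simp)
      (fun i hi => (_root_.abs_le.1 (hb i hi)).2) i (Finset.mem_univ i)⟩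

/-! ### Basic properties of flows. -/

namespace IsFlow

variable {n : ℕ} {A : Matrix (Fin n) (Fin n) ℝ} {f : ℝ → ℝ} {y N : ℝ → Fin n → ℝ}

theorem ae_differentiableAt (h : IsFlow A f y N) :
    ∀ᵐ t, ∀ i, DifferentiableAt ℝ (fun s => N s i) t := by
  obtain ⟨K, hK⟩ := h.lipschitz
  rw [ae_all_iff]
  intro i
  refine LipschitzWith.ae_differentiableAt_real (C := K.toNNReal)
    (LipschitzWith.of_dist_le_mul fun s t => ?_)
  rw [Real.dist_eq, Real.dist_eq]
  exact (hK s t i).trans (mul_le_mul_of_nonneg_right (Real.le_coe_toNNReal K) (abs_nonneg _))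

theorem hasDerivAt (h : IsFlow A f y N) {t : ℝ} {ν : Fin n → ℝ}
    (hν : ∀ i, HasDerivAt (fun s => N s i) (ν i) t) (i : Fin n) :
    HasDerivAt (fun s => y s i) (∑ j, A i j * (ν j - ν i)) t := by
  rw [funext fun s => h.eq s i]
  exact (HasDerivAt.fun_sum fun j _ => ((hν j).sub (hν i)).const_mul (A i j)).const_add _

theorem abs_sub_le (h : IsFlow A f y N) : ∃ K, ∀ s t i, |y s i - y t i| ≤ K * |s - t| := by
  obtain ⟨K, hK⟩ := h.lipschitz
  refine ⟨speedBound A K, fun s t i => ?_⟩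
  have h1 : y s i - y t i = ∑ j, A i j * ((N s j - N t j) - (N s i - N t i)) := by
    rw [h.eq s i, h.eq t i, add_sub_add_left_eq_sub, ← Finset.sum_sub_distrib]
    exact Finset.sum_congr rfl fun j _ => by ring
  rw [h1]
  refine (abs_sum_mul_sub_le_speedBound A (fun i => hK s t i) i).trans (le_of_eq ?_)
  simp only [speedBound, Finset.sum_mul, abs_mul, abs_abs, mul_assoc]

theorem isTrajectory (h : IsFlow A f y N) {a : ℝ} (ha : 0 ≤ a) (b : ℝ) :
    IsTrajectory A f a b y := by
  obtain ⟨K, hK⟩ := h.abs_sub_le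
  refine ⟨⟨K, fun s _ t _ => hK s t⟩, ?_⟩
  filter_upwards [h.ae_differentiableAt] with t ht htI
  exact ⟨fun i => deriv (fun s => N s i) t,
    fun i => h.isBetween t (ha.trans_lt htI.1) i _ (ht i).hasDerivAt,
    h.hasDerivAt fun i => (ht i).hasDerivAt⟩

theorem neg (h : IsFlow A f y N) :
    IsFlow A (fun r => -f (-r)) (fun t i => -y t i) (fun t i => -N t i) := by
  obtain ⟨K, hK⟩ := h.lipschitz
  refine ⟨⟨K, fun s t i => ?_⟩, fun t i => ?_, fun t ht i p hp => ?_⟩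
  · rw [← abs_neg, show -(-N s i - -N t i) = N s i - N t i by ring]
    exact hK s t i
  · rw [h.eq t i, neg_add, ← Finset.sum_neg_distrib]
    congr 1
    exact Finset.sum_congr rfl fun j _ => by ring
  · have := (h.isBetween t ht i (-p) (by convert! hp.neg using 1; funext s; simp)).neg
    simpa using this

theorem abs_le (h : IsFlow A f y N) (hA : ∀ i j, 0 ≤ A i j) {B : ℝ} (hB : ∀ i, |y 0 i| ≤ B)
    {t : ℝ} (ht : 0 ≤ t) (i : Fin n) : |y t i| ≤ B := by
  have h1 := h.isTrajectory le_rfl t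
  exact _root_.abs_le.2 ⟨h1.le_of_forall_ge hA ht (W := Finset.univ) (by simp)
      (fun i _ => (_root_.abs_le.1 (hB i)).1) i (Finset.mem_univ i),
    h1.le_of_forall_le hA ht (W := Finset.univ) (by simp)
      (fun i _ => (_root_.abs_le.1 (hB i)).2) i (Finset.mem_univ i)⟩

end IsFlow

/-! ### Existence and extension of solutions. -/

/-- Existence of solutions: the consensus protocol has a solution on `[0, ∞)` from each initial
value. -/
theorem exists_isFlow {n : ℕ} {A : Matrix (Fin n) (Fin n) ℝ} (hA : ∀ i j, 0 ≤ A i j) {f : ℝ → ℝ}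
    (hf : Monotone f) (x₀ : Fin n → ℝ) : ∃ y N, IsFlow A f y N ∧ y 0 = x₀ := by
  set R : ℝ := ‖x₀‖ + 1 with hR
  have hR0 : 0 ≤ R := by positivity
  -- Truncation bounds the Euler increments a priori. The limit stays within `‖x₀‖ < R`, where `g`
  -- and `f` agree nearby, so the truncation can be dropped.
  set g : ℝ → ℝ := fun r => f (max (-R) (min r R)) with hg
  have hgm : Monotone g := fun a b hab => hf (max_le_max le_rfl (min_le_min hab le_rfl))
  have hgb : ∀ r, |g r| ≤ max |f (-R)| |f R| := fun r =>
    abs_le_max_abs_abs (hf (le_max_left _ _)) (hf (max_le (by linarith) (min_le_right _ _)))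
  set h : ℕ → ℝ := fun k => 1 / ((k : ℝ) + 1) with hh
  let X : ℕ → ℕ → Fin n → ℝ := fun k m =>
    Nat.rec x₀ (fun _ x i => x i + h k * ∑ j, A i j * (g (x j) - g (x i))) m
  obtain ⟨y, N, hy, hlim⟩ := exists_isFlow_of_discrete A hgm (hyperfilter ℕ) (h := h)
    (δ := fun _ => 0) (X := X) (ν := fun k m i => g (X k m i)) (B := ‖x₀‖)
    (C := max |f (-R)| |f R|) (fun k => by positivity)
    (tendsto_one_div_add_atTop_nhds_zero_nat.mono_left Nat.hyperfilter_le_atTop)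
    tendsto_const_nhds (fun k m i => rfl) (fun k m i => by simp) (fun k m i => by simp)
    (fun k i => norm_le_pi_norm x₀ i) (fun k m i => hgb _)
  have hy0 : y 0 = x₀ := by
    funext i
    refine tendsto_nhds_unique (hlim 0 i) ?_
    simp only [zero_div, Nat.floor_zero]
    exact tendsto_const_nhds
  have hyb : ∀ t, 0 ≤ t → ∀ i, |y t i| ≤ ‖x₀‖ := fun t ht i =>
    hy.abs_le hA (fun i => by rw [hy0]; exact norm_le_pi_norm x₀ i) ht i
  refine ⟨y, N, ⟨hy.lipschitz, hy.eq, fun t ht i p hp => ?_⟩, hy0⟩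
  have hb := hy.isBetween t ht i p hp
  have hyt := abs_le.1 (hyb t ht.le i)
  constructor
  · intro r hr
    have h1 := hb.1 (max r (-R)) (max_lt hr (by linarith))
    refine (hf ?_).trans h1
    rw [min_eq_left (max_le (by linarith) (by linarith))]
    exact (le_max_left _ _).trans (le_max_right _ _)
  · intro r hr
    have h1 := hb.2 (min r R) (lt_min hr (by linarith))
    refine h1.trans (hf ?_)
    rw [min_eq_left (min_le_right r R)]
    exact max_le (le_min (by linarith) (by linarith) |>.trans (min_le_left r R)) (min_le_left _ _)

theorem eq_Ici_of_not_bddAbove {I : Set ℝ} (hI : I.OrdConnected) (h0 : 0 ∈ I) (hn : ∀ t ∈ I, 0 ≤ t)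
    (hb : ¬BddAbove I) : I = Ici 0 := by
  refine Subset.antisymm (fun t ht => hn t ht) fun t ht => ?_
  obtain ⟨s, hs, hts⟩ := not_bddAbove_iff.1 hb t
  exact hI.out h0 hs ⟨ht, hts.le⟩

theorem IsFlow.exists_lipschitzWith {n : ℕ} {A : Matrix (Fin n) (Fin n) ℝ} {f : ℝ → ℝ}
    {y N : ℝ → Fin n → ℝ} (h : IsFlow A f y N) : ∃ K, LipschitzWith K y := by
  obtain ⟨K, hK⟩ := h.abs_sub_le
  refine ⟨K.toNNReal, LipschitzWith.of_dist_le_mul fun s t => ?_⟩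
  refine (dist_pi_le_iff (by positivity)).2 fun i => ?_
  rw [Real.dist_eq, Real.dist_eq]
  exact (hK s t i).trans (mul_le_mul_of_nonneg_right (Real.le_coe_toNNReal K) (abs_nonneg _))

theorem IsSolution.exists_lipschitzOnWith {n : ℕ} {G : WeightedDigraph n} {f : ℝ → ℝ}
    (hf : Monotone f) {I : Set ℝ} {x : ℝ → Fin n → ℝ}
    (hx : IsSolution (consensusMap G fun _ => f) I x) : ∃ K, LipschitzOnWith K x I := by
  refine ⟨_, LipschitzOnWith.of_dist_le_mul (K := ⟨speedBound G.A
    (max |f (‖x 0‖ + 1)| |f (-‖x 0‖ - 1)|), speedBound_nonneg _ _⟩) fun s hs t ht => ?_⟩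
  refine (dist_pi_le_iff (mul_nonneg (NNReal.coe_nonneg _) dist_nonneg)).2 fun i => ?_
  rw [Real.dist_eq, Real.dist_eq]
  have key : ∀ T ∈ I, s ≤ T → t ≤ T → |x s i - x t i| ≤ speedBound G.A
      (max |f (‖x 0‖ + 1)| |f (-‖x 0‖ - 1)|) * |s - t| := fun T hT hsT htT =>
    (hx.isTrajectory hf hT).abs_sub_le (fun τ hτ i => hx.abs_le hf (hx.Icc_subset hT hτ) i)
      s ⟨hx.nonneg s hs, hsT⟩ t ⟨hx.nonneg t ht, htT⟩ i
  rcases le_total s t with hst | hst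
  · exact key t ht hst le_rfl
  · exact key s hs le_rfl hst

/-- A solution on a bounded interval extends to a solution on `[0, ∞)`. -/
theorem IsSolution.exists_extension {n : ℕ} {G : WeightedDigraph n} {f : ℝ → ℝ}
    (hf : Monotone f) {I : Set ℝ} {x : ℝ → Fin n → ℝ}
    (hx : IsSolution (consensusMap G fun _ => f) I x) (hb : BddAbove I) :
    ∃ w, IsSolution (consensusMap G fun _ => f) (Ici 0) w ∧ EqOn w x I := by
  obtain ⟨K, hK⟩ := hx.exists_lipschitzOnWith hf
  obtain ⟨g, hg, hgx⟩ := hK.extend_pi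
  set b := sSup I with hbdef
  have hIb : ∀ t ∈ I, t ≤ b := fun t ht => le_csSup hb ht
  have hb0 : 0 ≤ b := hIb 0 hx.zero_mem
  -- Restart at the endpoint value of the Lipschitz extension, which makes sense even if `b ∉ I`.
  -- The single formula below, with `min` and `max`, makes the glued function Lipschitz without a
  -- case split.
  obtain ⟨y, N, hy, hy0⟩ := exists_isFlow G.nonneg hf (g b)
  obtain ⟨K', hK'⟩ := hy.exists_lipschitzWith
  have hmin : LipschitzWith 1 fun t : ℝ => min t b := LipschitzWith.id.min_const b
  have hmax : LipschitzWith 1 fun t : ℝ => max (t - b) 0 :=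
    (LipschitzWith.of_dist_le_mul fun s t => by simp).max_const 0
  have hw : LipschitzWith (K * 1 + K' * 1)
      fun t => g (min t b) + y (max (t - b) 0) - y 0 := by
    have := (hg.comp hmin).add (hK'.comp hmax)
    refine LipschitzWith.of_dist_le_mul fun s t => ?_
    rw [dist_sub_right]
    exact this.dist_le_mul s t
  have hlow : ∀ t ≤ b, g (min t b) + y (max (t - b) 0) - y 0 = g t := fun t ht => by
    rw [min_eq_left ht, max_eq_right (by linarith), add_sub_cancel_right]
  have hhigh : ∀ t ≥ b, g (min t b) + y (max (t - b) 0) - y 0 = y (t - b) := fun t ht => by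
    rw [min_eq_right ht, max_eq_left (by linarith), hy0, add_sub_cancel_left]
  refine ⟨fun t => g (min t b) + y (max (t - b) 0) - y 0,
    ⟨ordConnected_Ici, self_mem_Ici, fun t ht => ht,
      fun t _ => hw.lipschitzOnWith.absolutelyContinuousOnInterval, ?_⟩,
    fun t ht => (hlow t (hIb t ht)).trans (hgx ht).symm⟩
  have h0 : ∀ᵐ t : ℝ, t ≠ 0 := by simp [ae_iff, measure_singleton]
  have h1 : ∀ᵐ t : ℝ, t ≠ b := by simp [ae_iff, measure_singleton]
  have h2 := (measurePreserving_sub_right volume b).quasiMeasurePreserving.ae hy.ae_differentiableAt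
  filter_upwards [h0, h1, h2, hx.inclusion] with t ht0 htb ht2 htx htI
  have ht0' : 0 < t := lt_of_le_of_ne htI ht0.symm
  rcases lt_or_gt_of_ne htb with h | h
  · obtain ⟨T, hT, htT⟩ := exists_lt_of_lt_csSup ⟨0, hx.zero_mem⟩ h
    have hnh : I ∈ 𝓝 t := mem_of_superset (Icc_mem_nhds ht0' htT) (hx.Icc_subset hT)
    have htI' : t ∈ I := mem_of_mem_nhds hnh
    obtain ⟨v, hv, hd⟩ := htx htI'
    refine ⟨v, ?_, ?_⟩
    · simp only [hlow t h.le]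
      rwa [← hgx htI']
    · refine ((hd.hasDerivAt hnh).congr_of_eventuallyEq ?_).hasDerivWithinAt
      filter_upwards [hnh] with s hs
      rw [hlow s (hIb s hs), hgx hs]
  · have hν : ∀ i, HasDerivAt (fun s => N s i) (deriv (fun s => N s i) (t - b)) (t - b) :=
      fun i => (ht2 i).hasDerivAt
    refine ⟨fun i => ∑ j, G.A i j *
      (deriv (fun s => N s j) (t - b) - deriv (fun s => N s i) (t - b)),
      (mem_consensusMap_iff hf).2 ⟨_, fun i => ?_, rfl⟩, ?_⟩
    · simp only [hhigh t h.le]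
      exact hy.isBetween _ (sub_pos.2 h) i _ (hν i)
    · have hd : HasDerivAt (fun s => y (s - b)) _ t :=
        (hasDerivAt_pi.2 fun i => hy.hasDerivAt hν i).comp_sub_const t b
      refine (hd.congr_of_eventuallyEq ?_).hasDerivWithinAt
      filter_upwards [lt_mem_nhds h] with s hs using hhigh s (le_of_lt hs)

theorem IsMaximalSolution.eq_Ici {n : ℕ} {G : WeightedDigraph n} {f : ℝ → ℝ}
    (hf : Monotone f) {I : Set ℝ} {x : ℝ → Fin n → ℝ}
    (hx : IsMaximalSolution (consensusMap G fun _ => f) I x) : I = Ici 0 := by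
  by_cases hb : BddAbove I
  · obtain ⟨w, hw, hwx⟩ := hx.1.exists_extension hf hb
    exact (hx.2 (Ici 0) w hw (fun t ht => hx.1.nonneg t ht) hwx).symm
  · exact eq_Ici_of_not_bddAbove hx.1.ordConnected hx.1.zero_mem hx.1.nonneg hb

/-! ### Limits of translates. -/

/-- An increment of a trajectory is `-L` applied to a vector of values of `f` near the initial
point. -/
theorem IsTrajectory.exists_increment {n : ℕ} {A : Matrix (Fin n) (Fin n) ℝ} {f : ℝ → ℝ}
    {a b K : ℝ} {x : ℝ → Fin n → ℝ} (hx : IsTrajectory A f a b x) (hab : a < b)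
    (hK : ∀ t ∈ Icc a b, ∀ i, |x t i - x a i| < K) :
    ∃ ν : Fin n → ℝ, (∀ i, f (x a i - K) ≤ ν i ∧ ν i ≤ f (x a i + K)) ∧
      ∀ i, x b i = x a i + (b - a) * ∑ j, A i j * (ν j - ν i) := by
  set Λ : (Fin n → ℝ) →ₗ[ℝ] (Fin n → ℝ) :=
    { toFun := fun ν i => ∑ j, A i j * (ν j - ν i)
      map_add' := fun u v => by
        funext i
        simp only [Pi.add_apply, ← Finset.sum_add_distrib]
        exact Finset.sum_congr rfl fun j _ => by ring
      map_smul' := fun c v => by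
        funext i
        simp only [Pi.smul_apply, smul_eq_mul, Finset.mul_sum, RingHom.id_apply]
        exact Finset.sum_congr rfl fun j _ => by ring } with hΛ
  set C : Set (Fin n → ℝ) :=
    Λ '' univ.pi fun i => Icc (f (x a i - K)) (f (x a i + K)) with hC
  have hCconv : Convex ℝ C := (convex_pi fun i _ => convex_Icc _ _).linear_image Λ
  have hCclosed : IsClosed C :=
    ((isCompact_univ_pi fun i => isCompact_Icc).image
      (LinearMap.continuous_of_finiteDimensional Λ)).isClosed
  obtain ⟨L, hL⟩ := hx.lipschitz
  have hac : ∀ i, AbsolutelyContinuousOnInterval (fun t => x t i) a b := fun i =>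
    absolutelyContinuousOnInterval_of_abs_sub_le hab.le fun s hs t ht => hL s hs t ht i
  have hb' : ∀ᵐ t : ℝ, t ≠ b := by simp [ae_iff, measure_singleton]
  have hmem : ∀ᵐ t ∂volume.restrict (Ioc a b), (fun i => deriv (fun s => x s i) t) ∈ C := by
    rw [ae_restrict_iff' measurableSet_Ioc]
    filter_upwards [hx.inclusion, hb'] with t ht htb htI
    obtain ⟨ν, h1, h2⟩ := ht ⟨htI.1, lt_of_le_of_ne htI.2 htb⟩
    refine ⟨ν, fun i _ => ?_, funext fun i => ((h2 i).deriv).symm⟩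
    have := abs_lt.1 (hK t (Ioc_subset_Icc_self htI) i)
    exact ⟨(h1 i).1 _ (by linarith), (h1 i).2 _ (by linarith)⟩
  have hint : IntegrableOn (fun t i => deriv (fun s => x s i) t) (Ioc a b) :=
    Integrable.of_eval fun i =>
      ((intervalIntegrable_iff_integrableOn_Ioc_of_le hab.le).1 (hac i).intervalIntegrable_deriv)
  -- The average velocity lies in the closed convex set `C` that contains almost all velocities.
  obtain ⟨ν, hν, hνe⟩ := hCconv.set_average_mem hCclosed (by simp [hab]) (by simp) hmem hint
  refine ⟨ν, fun i => hν i (mem_univ i), fun i => ?_⟩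
  have h1 := congrFun hνe i
  rw [setAverage_eq, Pi.smul_apply, eval_integral (fun i => hint.eval i),
    ← intervalIntegral.integral_of_le hab.le, (hac i).integral_deriv_eq_sub] at h1
  simp only [measureReal_def, Real.volume_Ioc, smul_eq_mul,
    ENNReal.toReal_ofReal (sub_nonneg.2 hab.le)] at h1
  have h2 : ∑ j, A i j * (ν j - ν i) = (b - a)⁻¹ * (x b i - x a i) := h1
  rw [h2, mul_inv_cancel_left₀ (sub_pos.2 hab).ne']
  ring

/-- The translates of a bounded trajectory on `[0, ∞)` have a limit that is again a solution, along
with an integrated selection of the Filippov map. -/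
theorem exists_isFlow_of_translates {n : ℕ} {A : Matrix (Fin n) (Fin n) ℝ} {f : ℝ → ℝ}
    (hf : Monotone f) {x : ℝ → Fin n → ℝ} (hx : ∀ T, IsTrajectory A f 0 T x) {B : ℝ}
    (hB : ∀ t, 0 ≤ t → ∀ i, |x t i| ≤ B) :
    ∃ y N, IsFlow A f y N ∧ ∀ t, ∃ τ : ℕ → ℝ, Tendsto τ (hyperfilter ℕ) atTop ∧
      ∀ i, Tendsto (fun k => x (τ k) i) (hyperfilter ℕ) (𝓝 (y t i)) := by
  set K := speedBound A (max |f (B + 1)| |f (-B - 1)|) with hK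
  have hK0 : 0 ≤ K := speedBound_nonneg _ _
  set h : ℕ → ℝ := fun k => 1 / ((k : ℝ) + 1) with hh
  have hpos : ∀ k, 0 < h k := fun k => by positivity
  have hle : ∀ k, h k ≤ 1 := fun k => by
    rw [hh]
    exact (div_le_one (by positivity)).2 (by linarith [(Nat.cast_nonneg k : (0 : ℝ) ≤ k)])
  have hlim : Tendsto h (hyperfilter ℕ) (𝓝 0) :=
    tendsto_one_div_add_atTop_nhds_zero_nat.mono_left Nat.hyperfilter_le_atTop
  -- The `k`-th translate starts at time `k` and is sampled with step `h k`. The radius uses `K + 1`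
  -- because the displacement, at most `K * h k`, must be strictly smaller.
  have hinc : ∀ k m : ℕ, ∃ ν : Fin n → ℝ,
      (∀ i, f (x (k + h k * m) i - (K + 1) * h k) ≤ ν i ∧
        ν i ≤ f (x (k + h k * m) i + (K + 1) * h k)) ∧
      ∀ i, x (k + h k * (m + 1 : ℕ)) i = x (k + h k * m) i +
        h k * ∑ j, A i j * (ν j - ν i) := by
    intro k m
    have h0 : 0 ≤ (k : ℝ) + h k * m := by have := hpos k; positivity
    have hab : (k : ℝ) + h k * m < k + h k * (m + 1 : ℕ) := by
      push_cast
      linarith [hpos k]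
    have hw : (k : ℝ) + h k * (m + 1 : ℕ) - (k + h k * m) = h k := by push_cast; ring
    obtain ⟨ν, h1, h2⟩ := ((hx (k + h k * (m + 1 : ℕ))).mono h0 le_rfl).exists_increment
      (K := (K + 1) * h k) hab (by
        intro t ht i
        have := ((hx t).mono h0 le_rfl).abs_sub_le (B := B)
          (fun s hs i => hB s (h0.trans hs.1) i) t ⟨ht.1, le_rfl⟩ _ ⟨le_rfl, ht.1⟩ i
        refine this.trans_lt ?_
        rw [abs_of_nonneg (sub_nonneg.2 ht.1)]
        have h3 : K * (t - (k + h k * m)) ≤ K * h k :=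
          mul_le_mul_of_nonneg_left (by linarith [ht.2]) hK0
        have := hpos k
        linarith)
    refine ⟨ν, h1, fun i => ?_⟩
    rw [h2 i, hw]
  choose ν hν₁ hν₂ using hinc
  have hδ : Tendsto (fun k => (K + 1) * h k) (hyperfilter ℕ) (𝓝 0) := by
    simpa using hlim.const_mul (K + 1)
  obtain ⟨y, N, hy, hyx⟩ := exists_isFlow_of_discrete A hf (hyperfilter ℕ) hpos hlim hδ
    (X := fun k m => x (k + h k * m)) (ν := ν) (B := B)
    (C := max |f (-(B + (K + 1)))| |f (B + (K + 1))|)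
    (fun k m i => hν₂ k m i) (fun k m i => (hν₁ k m i).1) (fun k m i => (hν₁ k m i).2)
    (fun k i => hB _ (by simp) i) (fun k m i => by
      have h1 := abs_le.1 (hB (k + h k * m) (by have := hpos k; positivity) i)
      have h2 : (K + 1) * h k ≤ K + 1 := mul_le_of_le_one_right (by linarith) (hle k)
      exact abs_le_max_abs_abs ((hf (by linarith)).trans (hν₁ k m i).1)
        ((hν₁ k m i).2.trans (hf (by linarith))))
  refine ⟨y, N, hy, fun t => ⟨fun k => k + h k * ⌊t / h k⌋₊, ?_, fun i => hyx t i⟩⟩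
  refine tendsto_atTop_mono (fun k => ?_)
    ((tendsto_natCast_atTop_atTop (R := ℝ)).mono_left Nat.hyperfilter_le_atTop)
  have := hpos k
  have : 0 ≤ h k * ⌊t / h k⌋₊ := by positivity
  linarith

/-- If the maximum of a trajectory converges, it is constant along a limit of translates. -/
theorem sup'_eq_of_tendsto {n : ℕ} {x : ℝ → Fin n → ℝ} {z : Fin n → ℝ} {τ : ℕ → ℝ} {M : ℝ}
    (hn : (Finset.univ : Finset (Fin n)).Nonempty)
    (hM : Tendsto (fun t => Finset.univ.sup' hn (x t)) atTop (𝓝 M))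
    (hτ : Tendsto τ (hyperfilter ℕ) atTop)
    (hz : ∀ i, Tendsto (fun k => x (τ k) i) (hyperfilter ℕ) (𝓝 (z i))) :
    Finset.univ.sup' hn z = M := by
  refine tendsto_nhds_unique (f := fun k => Finset.univ.sup' hn (x (τ k)))
    (l := (hyperfilter ℕ : Filter ℕ)) ?_ (hM.comp hτ)
  exact Tendsto.finset_sup'_nhds_apply hn fun i _ => hz i

/-! ### Flows with constant maximum. -/

namespace IsFlow

variable {n : ℕ} {A : Matrix (Fin n) (Fin n) ℝ} {f : ℝ → ℝ} {y N : ℝ → Fin n → ℝ}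

theorem le_sub_of_forall_le_deriv (h : IsFlow A f y N) {i : Fin n} {c a b : ℝ}
    (hab : a ≤ b) (hc : ∀ t, a < t → (∀ i, DifferentiableAt ℝ (fun s => N s i) t) →
      c ≤ deriv (fun s => N s i) t) : c * (b - a) ≤ N b i - N a i := by
  obtain ⟨K, hK⟩ := h.lipschitz
  refine (absolutelyContinuousOnInterval_of_abs_sub_le (u := fun s => N s i) hab
    fun s _ t _ => hK s t i).le_sub_of_ae_le_hasDerivAt hab ?_
  filter_upwards [h.ae_differentiableAt] with t ht htI
  exact ⟨_, hc t htI.1 ht, (ht i).hasDerivAt⟩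

theorem sub_le_of_forall_deriv_le (h : IsFlow A f y N) {i : Fin n} {c a b : ℝ}
    (hab : a ≤ b) (hc : ∀ t, a < t → (∀ i, DifferentiableAt ℝ (fun s => N s i) t) →
      deriv (fun s => N s i) t ≤ c) : N b i - N a i ≤ c * (b - a) := by
  obtain ⟨K, hK⟩ := h.lipschitz
  refine (absolutelyContinuousOnInterval_of_abs_sub_le (u := fun s => N s i) hab
    fun s _ t _ => hK s t i).sub_le_of_ae_hasDerivAt_le hab ?_
  filter_upwards [h.ae_differentiableAt] with t ht htI
  exact ⟨_, hc t htI.1 ht, (ht i).hasDerivAt⟩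

/-- If `f` takes the value `c` to the left of `M` and all selected values are at most `c`, then a
node that is at `M` has been there at all earlier times. -/
theorem eq_of_eq_of_le (h : IsFlow A f y N) (hA : ∀ i j, 0 ≤ A i j) {M c s₀ : ℝ} (hs₀ : s₀ < M)
    (hfs₀ : c ≤ f s₀) (hM : ∀ t, 0 ≤ t → ∀ i, y t i ≤ M)
    (hc : ∀ t, 0 < t → (∀ i, DifferentiableAt ℝ (fun s => N s i) t) →
      ∀ i, deriv (fun s => N s i) t ≤ c) {t t' : ℝ} (ht : 0 ≤ t) (htt' : t ≤ t') {i : Fin n}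
    (hi : y t' i = M) : y t i = M := by
  by_contra hne
  have hlt : y t i < M := lt_of_le_of_ne (hM t ht i) hne
  -- Above level `p ≥ s₀` the node has selected value at least `c`, hence at least all others, and
  -- cannot rise; so `max (y s i) p` is nonincreasing and cannot climb to `M`.
  set p := max s₀ (y t i) with hp
  have hpM : p < M := max_lt hs₀ hlt
  obtain ⟨K, hK⟩ := h.abs_sub_le
  have hac : AbsolutelyContinuousOnInterval (fun s => max (y s i) p) t t' :=
    absolutelyContinuousOnInterval_of_abs_sub_le (K := K) htt' fun s _ r _ => by
      refine (abs_max_sub_max_le_abs _ _ _).trans (hK s r i)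
  have := hac.sub_le_of_ae_hasDerivAt_le (C := 0) htt' (by
    filter_upwards [h.ae_differentiableAt, hac.ae_differentiableAt] with s hs hd hsI
    have hd := (hd (by rw [uIcc_of_le htt']; exact Ioo_subset_Icc_self hsI)).hasDerivAt
    have hs0 : 0 < s := ht.trans_lt hsI.1
    refine ⟨_, ?_, hd⟩
    rcases le_or_gt (y s i) p with h1 | h1
    · exact ((hasDerivAt_const s p).eq_of_le_of_eq hd
        (Eventually.of_forall fun r => le_max_right _ _) (max_eq_right h1).symm).ge
    · rw [← (h.hasDerivAt (fun i => (hs i).hasDerivAt) i).eq_of_le_of_eq hd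
        (Eventually.of_forall fun r => le_max_left _ _) (max_eq_left h1.le).symm]
      refine Finset.sum_nonpos fun j _ => mul_nonpos_of_nonneg_of_nonpos (hA i j) ?_
      have h2 := (h.isBetween s hs0 i _ (hs i).hasDerivAt).1 s₀ ((le_max_left _ _).trans_lt h1)
      linarith [hc s hs0 hs j])
  rw [hi, max_eq_left hpM.le, max_eq_right (le_max_right s₀ (y t i))] at this
  linarith

/-- If all selected values are at most `c`, then the integrated deficit of a node bounds that of its
in-neighbours. -/
theorem exists_deficit_le_of_adj (h : IsFlow A f y N) (hA : ∀ i j, 0 ≤ A i j) {c : ℝ}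
    (hc : ∀ t, 0 < t → (∀ i, DifferentiableAt ℝ (fun s => N s i) t) →
      ∀ i, deriv (fun s => N s i) t ≤ c) {i k : Fin n} (hik : 0 < A i k)
    (hi : ∃ C, ∀ t, 0 ≤ t → c * t - (N t i - N 0 i) ≤ C) :
    ∃ C, ∀ t, 0 ≤ t → c * t - (N t k - N 0 k) ≤ C := by
  obtain ⟨C, hC⟩ := hi
  refine ⟨((∑ j, A i j) * C + 2 * ‖y 0‖) / A i k, fun t ht => ?_⟩
  rw [le_div_iff₀ hik, mul_comm]
  have hw : ∀ j, 0 ≤ c * t - (N t j - N 0 j) := fun j => by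
    have := h.sub_le_of_forall_deriv_le (i := j) ht fun t ht hd => hc t ht hd j
    rw [sub_zero] at this
    linarith
  have h1 : A i k * (c * t - (N t k - N 0 k)) ≤ ∑ j, A i j * (c * t - (N t j - N 0 j)) :=
    Finset.single_le_sum (f := fun j => A i j * (c * t - (N t j - N 0 j)))
      (fun j _ => mul_nonneg (hA i j) (hw j)) (Finset.mem_univ k)
  -- The integrated equation at node `i`, written in terms of deficits; its last term is bounded
  -- because the flow is.
  have h2 : ∑ j, A i j * (c * t - (N t j - N 0 j)) =
      (∑ j, A i j) * (c * t - (N t i - N 0 i)) - (y t i - y 0 i) := by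
    have h3 := h.eq t i
    have h4 := h.eq 0 i
    have h5 : y t i - y 0 i =
        ∑ j, A i j * (N t j - N t i) - ∑ j, A i j * (N 0 j - N 0 i) := by linarith
    rw [h5, Finset.sum_mul, ← Finset.sum_sub_distrib, ← Finset.sum_sub_distrib]
    exact Finset.sum_congr rfl fun j _ => by ring
  have h6 : (∑ j, A i j) * (c * t - (N t i - N 0 i)) ≤ (∑ j, A i j) * C :=
    mul_le_mul_of_nonneg_left (hC t ht) (Finset.sum_nonneg fun j _ => hA i j)
  have h7 := _root_.abs_le.1 (h.abs_le hA (fun i => norm_le_pi_norm (y 0) i) ht i)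
  have h8 := _root_.abs_le.1 (norm_le_pi_norm (y 0) i)
  linarith

/-- If the maximum of the solution is constantly `M`, then the integral of the selected values at a
root is at least that of the left limit of `f` at `M`, up to a constant. -/
theorem exists_deficit_le (h : IsFlow A f y N) (hA : ∀ i j, 0 ≤ A i j) {M c : ℝ}
    (hM : ∀ t, 0 ≤ t → ∀ i, y t i ≤ M) (hM' : ∀ t, 0 ≤ t → ∃ i, y t i = M)
    (hc : IsLUB (f '' Iio M) c) {r : Fin n}
    (hr : ∀ i, Relation.ReflTransGen (fun j i => 0 < A i j) r i) :
    ∃ C, ∀ t, 0 ≤ t → c * t - (N t r - N 0 r) ≤ C := by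
  classical
  have hbet : ∀ t, 0 < t → (∀ i, DifferentiableAt ℝ (fun s => N s i) t) →
      ∀ i, IsBetween f (y t i) (deriv (fun s => N s i) t) := fun t ht hd i =>
    h.isBetween t ht i _ (hd i).hasDerivAt
  have hge : ∀ t, 0 < t → (∀ i, DifferentiableAt ℝ (fun s => N s i) t) →
      ∀ i, y t i = M → c ≤ deriv (fun s => N s i) t := by
    intro t ht hd i hi
    refine hc.2 ?_
    rintro _ ⟨s, hs, rfl⟩
    exact (hbet t ht hd i).1 s (by rw [hi]; exact hs)
  have hmax : ∀ t, 0 < t → (∀ i, DifferentiableAt ℝ (fun s => N s i) t) →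
      ∃ i, y t i = M ∧ ∀ j, deriv (fun s => N s j) t ≤ deriv (fun s => N s i) t := by
    intro t ht hd
    obtain ⟨i₀, hi₀⟩ := hM' t ht.le
    obtain ⟨i, hi, him⟩ := (Finset.univ.filter fun i => y t i = M).exists_max_image
      (fun i => deriv (fun s => N s i) t) ⟨i₀, by simp [hi₀]⟩
    have hiM : y t i = M := by simpa using hi
    refine ⟨i, hiM, fun j => ?_⟩
    rcases (hM t ht.le j).eq_or_lt with hj | hj
    · exact him j (by simp [hj])
    · exact (hbet t ht hd j).le (hbet t ht hd i) (by rw [hiM]; exact hj)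
  -- A node at `M` touches its upper bound, so its velocity vanishes; all terms of the sum are
  -- nonpositive, so each is zero.
  have hadj : ∀ t, 0 < t → (∀ i, DifferentiableAt ℝ (fun s => N s i) t) → ∀ i, y t i = M →
      (∀ j, deriv (fun s => N s j) t ≤ deriv (fun s => N s i) t) →
      ∀ j, 0 < A i j → deriv (fun s => N s j) t = deriv (fun s => N s i) t := by
    intro t ht hd i hi him j hj
    have h0 := (h.hasDerivAt (fun i => (hd i).hasDerivAt) i).eq_of_le_of_eq
      (hasDerivAt_const t M) (by filter_upwards [lt_mem_nhds ht] with s hs using hM s hs.le i) hi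
    have h1 := (Finset.sum_eq_zero_iff_of_nonpos fun j _ =>
      mul_nonpos_of_nonneg_of_nonpos (hA i j) (sub_nonpos.2 (him j))).1 h0 j (Finset.mem_univ j)
    rcases mul_eq_zero.1 h1 with h2 | h2
    · exact absurd h2 hj.ne'
    · linarith
  have hanc : ∀ t, 0 < t → (∀ i, DifferentiableAt ℝ (fun s => N s i) t) → ∀ i, y t i = M →
      (∀ j, deriv (fun s => N s j) t ≤ deriv (fun s => N s i) t) →
      (∀ j, deriv (fun s => N s j) t = deriv (fun s => N s i) t → y t j = M) →
      ∀ k, Relation.ReflTransGen (fun j i => 0 < A i j) k i → y t k = M := by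
    intro t ht hd i hi him hiM k hk
    suffices y t k = M ∧ deriv (fun s => N s k) t = deriv (fun s => N s i) t from this.1
    induction hk using Relation.ReflTransGen.head_induction_on with
    | refl => exact ⟨hi, rfl⟩
    | head hab _ ih =>
      have := (hadj t ht hd _ ih.1 (fun j => by rw [ih.2]; exact him j) _ hab).trans ih.2
      exact ⟨hiM _ this, this⟩
  -- Either the left limit `c` is never exceeded, or some node at `M` makes use of a jump of `f`
  -- there.
  by_cases hcase : ∀ t, 0 < t → (∀ i, DifferentiableAt ℝ (fun s => N s i) t) →
      ∀ i, deriv (fun s => N s i) t ≤ c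
  · by_cases hflat : ∃ s₀ < M, c ≤ f s₀
    · obtain ⟨s₀, hs₀, hfs₀⟩ := hflat
      -- By pigeonhole one node is at `M` at arbitrarily late times, hence always. Its deficit is at
      -- most zero, and bounds on deficits travel against the edges to the root.
      choose i hi using fun k : ℕ => hM' k (Nat.cast_nonneg k)
      obtain ⟨j, hj⟩ := Finite.exists_infinite_fiber i
      have hj' : ∀ t, 0 ≤ t → y t j = M := by
        intro t ht
        obtain ⟨k, hk, htk⟩ := (infinite_coe_iff.1 hj).exists_gt ⌈t⌉₊
        have hk' : i k = j := hk
        refine h.eq_of_eq_of_le hA hs₀ hfs₀ hM hcase ht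
          ((Nat.le_ceil t).trans (by exact_mod_cast htk.le)) (t' := k) ?_
        rw [← hk']
        exact hi k
      have hjC : ∃ C, ∀ t, 0 ≤ t → c * t - (N t j - N 0 j) ≤ C := ⟨0, fun t ht => by
        have := h.le_sub_of_forall_le_deriv (i := j) ht fun t ht hd =>
          hge t ht hd j (hj' t ht.le)
        rw [sub_zero] at this
        linarith⟩
      have hrj := hr j
      clear hr
      induction hrj using Relation.ReflTransGen.head_induction_on with
      | refl => exact hjC
      | head hab _ ih => exact h.exists_deficit_le_of_adj hA hcase hab ih
    -- Now `f < c` left of `M`, so a value at least `c` forces its node to be at `M`. Equality of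
    -- values therefore carries position `M` from a maximal node back to the root.
    · push Not at hflat
      refine ⟨0, fun t ht => ?_⟩
      have := h.le_sub_of_forall_le_deriv (c := c) (i := r) ht fun t ht hd => by
        obtain ⟨i, hi, him⟩ := hmax t ht hd
        refine hge t ht hd r (hanc t ht hd i hi him (fun j hj => ?_) r (hr i))
        by_contra hne
        have hlt := lt_of_le_of_ne (hM t ht.le j) hne
        have h1 := (hbet t ht hd j).2 ((y t j + M) / 2) (by linarith)
        have h2 := hflat ((y t j + M) / 2) (by linarith)
        linarith [hge t ht hd i hi]
      rw [sub_zero] at this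
      linarith
  · push Not at hcase
    obtain ⟨t, ht, hd, k, hk⟩ := hcase
    obtain ⟨i, hi, him⟩ := hmax t ht hd
    -- The maximal value at time `t` exceeds `c`, which is impossible for a node below `M`; so all
    -- ancestors of `i` are at `M`.
    have hall := hanc t ht hd i hi him fun j hj => by
      by_contra hne
      have hlt := lt_of_le_of_ne (hM t ht.le j) hne
      have h1 := (hbet t ht hd j).2 ((y t j + M) / 2) (by linarith)
      have h2 := hc.1 (mem_image_of_mem f (show (y t j + M) / 2 ∈ Iio M by
        rw [mem_Iio]; linarith))
      linarith [him k]
    -- The ancestors of the root have no in-neighbours outside their set, so their minimum, equal to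
    -- `M` at time `t`, never decreases.
    have hroot : ∀ s, t ≤ s → y s r = M := fun s hs =>
      le_antisymm (hM s (ht.le.trans hs) r) <|
        (h.isTrajectory ht.le s).le_of_forall_ge hA hs
          (W := Finset.univ.filter fun j => Relation.ReflTransGen (fun j i => 0 < A i j) j r)
          (fun i hi j hij => by
            rw [Finset.mem_filter] at hi ⊢
            exact ⟨Finset.mem_univ j, hi.2.head hij⟩)
          (fun j hj => (hall j ((Finset.mem_filter.1 hj).2.trans (hr i))).ge) r
          (by simp [Relation.ReflTransGen.refl])
    obtain ⟨K, hK⟩ := h.lipschitz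
    refine ⟨(|c| + |K|) * t, fun s hs => ?_⟩
    have hKs : ∀ s, 0 ≤ s → s ≤ t → c * s - (N s r - N 0 r) ≤ (|c| + |K|) * t := by
      intro s hs hst
      have h1 := (_root_.abs_le.1 (hK s 0 r)).1
      rw [sub_zero, abs_of_nonneg hs] at h1
      have h2 : c * s ≤ |c| * t :=
        (mul_le_mul_of_nonneg_right (le_abs_self c) hs).trans
          (mul_le_mul_of_nonneg_left hst (abs_nonneg c))
      have h3 : K * s ≤ |K| * t :=
        (mul_le_mul_of_nonneg_right (le_abs_self K) hs).trans
          (mul_le_mul_of_nonneg_left hst (abs_nonneg K))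
      linarith
    rcases le_total s t with hst | hst
    · exact hKs s hs hst
    · have h1 := hKs t ht.le le_rfl
      have h2 := h.le_sub_of_forall_le_deriv (i := r) hst fun s hs hd =>
        hge s (ht.trans hs) hd r (hroot s hs.le)
      linarith

end IsFlow

/-! ### Convergence to the consensus set and its invariance. -/

theorem WeightedDigraph.HasSpanningTree.exists_root {n : ℕ} {G : WeightedDigraph n}
    (hG : G.HasSpanningTree) : ∃ r, ∀ i, Relation.ReflTransGen (fun j i => 0 < G.A i j) r i := by
  obtain ⟨T, r, hT, -, -, hr⟩ := hG
  exact ⟨r, fun i => Relation.ReflTransGen.mono (fun a b hab => (G.pos_iff b a).2 (hT hab)) r i (hr i)⟩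

theorem Monotone.exists_isLUB_image_Iio {f : ℝ → ℝ} (hf : Monotone f) (M : ℝ) :
    ∃ c, IsLUB (f '' Iio M) c := by
  refine ⟨_, isLUB_csSup (nonempty_Iio.image f) ⟨f M, ?_⟩⟩
  rintro _ ⟨s, hs, rfl⟩
  exact hf (le_of_lt hs)

theorem IsTrajectory.exists_tendsto_sup' {n : ℕ} {A : Matrix (Fin n) (Fin n) ℝ}
    (hA : ∀ i j, 0 ≤ A i j) {f : ℝ → ℝ} {x : ℝ → Fin n → ℝ} (hx : ∀ T, IsTrajectory A f 0 T x)
    {B : ℝ} (hB : ∀ t, 0 ≤ t → ∀ i, |x t i| ≤ B)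
    (hn : (Finset.univ : Finset (Fin n)).Nonempty) :
    ∃ M, Tendsto (fun t => Finset.univ.sup' hn (x t)) atTop (𝓝 M) := by
  have hanti : Antitone fun t => Finset.univ.sup' hn (x (max t 0)) := fun s t hst =>
    ((hx _).mono (le_max_right s 0) le_rfl).sup'_le hA (max_le_max hst le_rfl) hn (by simp)
  have hbdd : BddBelow (range fun t => Finset.univ.sup' hn (x (max t 0))) := by
    refine ⟨-B, ?_⟩
    rintro _ ⟨t, rfl⟩
    obtain ⟨i, hi⟩ := hn
    exact (abs_le.1 (hB _ (le_max_right t 0) i)).1.trans (Finset.le_sup' (x (max t 0)) hi)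
  refine ⟨_, (tendsto_atTop_ciInf hanti hbdd).congr' ?_⟩
  filter_upwards [eventually_ge_atTop 0] with t ht
  rw [max_eq_left ht]

/-- Along a trajectory on `[0, ∞)`, the limit of the maximum and the limit of the minimum lie in the
same closed interval on which `f` is essentially constant. -/
theorem IsTrajectory.isLUB_add_isLUB_nonpos {n : ℕ} {A : Matrix (Fin n) (Fin n) ℝ}
    (hA : ∀ i j, 0 ≤ A i j) {r : Fin n}
    (hr : ∀ i, Relation.ReflTransGen (fun j i => 0 < A i j) r i) {f : ℝ → ℝ} (hf : Monotone f)
    {x : ℝ → Fin n → ℝ} (hx : ∀ T, IsTrajectory A f 0 T x) {B : ℝ}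
    (hB : ∀ t, 0 ≤ t → ∀ i, |x t i| ≤ B) (hn : (Finset.univ : Finset (Fin n)).Nonempty)
    {M m c d : ℝ} (hM : Tendsto (fun t => Finset.univ.sup' hn (x t)) atTop (𝓝 M))
    (hm : Tendsto (fun t => Finset.univ.sup' hn fun i => -x t i) atTop (𝓝 m))
    (hc : IsLUB (f '' Iio M) c) (hd : IsLUB ((fun s => -f (-s)) '' Iio m) d) : c + d ≤ 0 := by
  obtain ⟨y, N, hy, hyx⟩ := exists_isFlow_of_translates hf hx hB
  have hyM : ∀ t, Finset.univ.sup' hn (y t) = M := fun t => by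
    obtain ⟨τ, hτ, hz⟩ := hyx t
    exact sup'_eq_of_tendsto hn hM hτ hz
  have hym : ∀ t, (Finset.univ.sup' hn fun i => -y t i) = m := fun t => by
    obtain ⟨τ, hτ, hz⟩ := hyx t
    exact sup'_eq_of_tendsto (x := fun t i => -x t i) hn hm hτ fun i => (hz i).neg
  obtain ⟨C, hC⟩ := hy.exists_deficit_le hA (M := M)
    (fun t _ i => (hyM t) ▸ Finset.le_sup' (y t) (Finset.mem_univ i))
    (fun t _ => by
      obtain ⟨i, -, hi⟩ := Finset.univ.exists_mem_eq_sup' hn (y t)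
      exact ⟨i, hi.symm.trans (hyM t)⟩) hc hr
  obtain ⟨C', hC'⟩ := hy.neg.exists_deficit_le hA (M := m)
    (fun t _ i => (hym t) ▸ Finset.le_sup' (fun i => -y t i) (Finset.mem_univ i))
    (fun t _ => by
      obtain ⟨i, -, hi⟩ := Finset.univ.exists_mem_eq_sup' hn fun i => -y t i
      exact ⟨i, hi.symm.trans (hym t)⟩) hd hr
  by_contra! hcd
  -- Adding the two deficit bounds cancels `N` and leaves `(c + d) t ≤ C + C'`, which fails at this
  -- time.
  have ht : 0 ≤ (|C + C'| + 1) / (c + d) := by positivity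
  have h1 := hC _ ht
  have h2 := hC' _ ht
  have h3 : (c + d) * ((|C + C'| + 1) / (c + d)) = |C + C'| + 1 := mul_div_cancel₀ _ hcd.ne'
  linarith [le_abs_self (C + C')]

theorem mem_consensusSet_iff {n : ℕ} {f : ℝ → ℝ} (hf : Monotone f) {x : Fin n → ℝ} :
    x ∈ consensusSet (fun _ => f) ↔ ∃ a, ∀ i, IsBetween f (x i) a := by
  simp only [consensusSet, mem_ofPred_eq, mem_univ_pi, hf.mem_filippov_iff]

theorem IsTrajectory.convergesToSet {n : ℕ} {A : Matrix (Fin n) (Fin n) ℝ}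
    (hA : ∀ i j, 0 ≤ A i j) {r : Fin n}
    (hr : ∀ i, Relation.ReflTransGen (fun j i => 0 < A i j) r i) {f : ℝ → ℝ} (hf : Monotone f)
    {x : ℝ → Fin n → ℝ} (hx : ∀ T, IsTrajectory A f 0 T x) {B : ℝ}
    (hB : ∀ t, 0 ≤ t → ∀ i, |x t i| ≤ B) : ConvergesToSet x (consensusSet fun _ => f) := by
  have hn : (Finset.univ : Finset (Fin n)).Nonempty := ⟨r, Finset.mem_univ r⟩
  obtain ⟨M, hM⟩ := exists_tendsto_sup' hA hx hB hn
  obtain ⟨m, hm⟩ := exists_tendsto_sup' hA (fun T => (hx T).neg)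
    (fun t ht i => by rw [abs_neg]; exact hB t ht i) hn
  obtain ⟨c, hc⟩ := hf.exists_isLUB_image_Iio M
  have hf' : Monotone fun s => -f (-s) := fun a b hab => neg_le_neg (hf (neg_le_neg hab))
  obtain ⟨d, hd⟩ := hf'.exists_isLUB_image_Iio m
  have hcd := isLUB_add_isLUB_nonpos hA hr hf hx hB hn hM hm hc hd
  have hmM : -m ≤ M := by
    refine le_of_tendsto_of_tendsto' hm.neg hM fun t => ?_
    have h1 := Finset.le_sup' (fun i => -x t i) (Finset.mem_univ r)
    have h2 := Finset.le_sup' (x t) (Finset.mem_univ r)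
    linarith
  intro ε hε
  filter_upwards [hM.eventually_lt_const (show M < M + ε by linarith),
    hm.eventually_lt_const (show m < m + ε by linarith)] with t h1 h2
  -- Clamping to `[-m, M]` moves each coordinate by less than `ε`. The common value is `c`: `f ≤ c`
  -- left of `M`, and `f ≥ -d ≥ c` right of `-m`.
  refine ⟨fun i => max (-m) (min (x t i) M), (mem_consensusSet_iff hf).2 ⟨c, fun i => ⟨?_, ?_⟩⟩,
    (dist_pi_lt_iff hε).2 fun i => ?_⟩
  · intro s hs
    exact hc.1 ⟨s, hs.trans_le (max_le hmM (min_le_right _ _)), rfl⟩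
  · intro s hs
    have h3 : -f (- -s) ≤ d := hd.1 ⟨-s, by
      have := (le_max_left (-m) (min (x t i) M)).trans_lt hs
      rw [mem_Iio]
      linarith, rfl⟩
    rw [neg_neg] at h3
    linarith
  · have h3 := (Finset.le_sup' (x t) (Finset.mem_univ i)).trans_lt h1
    have h4 := (Finset.le_sup' (fun i => -x t i) (Finset.mem_univ i)).trans_lt h2
    rw [Real.dist_eq, abs_lt]
    rcases max_cases (-m) (min (x t i) M) with h5 | h5 <;>
      rcases min_cases (x t i) M with h6 | h6 <;> constructor <;> linarith

/-- The initial common value `a` persists: if `f s > a`, then no coordinate starts above `s`, so by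
the maximum principle none ever gets above `s`; symmetrically from below. -/
theorem IsSolution.mem_consensusSet {n : ℕ} {G : WeightedDigraph n} {f : ℝ → ℝ} (hf : Monotone f)
    {I : Set ℝ} {x : ℝ → Fin n → ℝ} (hx : IsSolution (consensusMap G fun _ => f) I x)
    (h0 : x 0 ∈ consensusSet fun _ => f) {t : ℝ} (ht : t ∈ I) : x t ∈ consensusSet fun _ => f := by
  obtain ⟨a, ha⟩ := (mem_consensusSet_iff hf).1 h0
  have hxt := hx.isTrajectory hf ht
  have h0t := hx.nonneg t ht
  refine (mem_consensusSet_iff hf).2 ⟨a, fun i => ⟨fun s hs => ?_, fun s hs => ?_⟩⟩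
  · by_contra! h
    refine hs.not_ge (hxt.le_of_forall_le G.nonneg h0t (W := Finset.univ) (by simp)
      (fun j _ => ?_) i (Finset.mem_univ i))
    by_contra! hj
    exact h.not_ge ((ha j).1 s hj)
  · by_contra! h
    refine hs.lt.not_ge (hxt.le_of_forall_ge G.nonneg h0t (W := Finset.univ) (by simp)
      (fun j _ => ?_) i (Finset.mem_univ i))
    by_contra! hj
    exact h.not_ge ((ha j).2 s hj)

theorem mainTheorem2 {n : ℕ} (G : WeightedDigraph n) (hG : G.HasSpanningTree)
    (fbar : ℝ → ℝ) (hmono : Monotone fbar) (hlim : Tendsto (fun s => |fbar s|) atTop atTop) :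
    (∀ (I : Set ℝ) (x : ℝ → Fin n → ℝ), IsSolution (consensusMap G fun _ => fbar) I x →
        Bornology.IsBounded (x '' I)) ∧
      (∀ (I : Set ℝ) (x : ℝ → Fin n → ℝ), IsMaximalSolution (consensusMap G fun _ => fbar) I x →
        I = Set.Ici 0 ∧ ConvergesToSet x (consensusSet fun _ => fbar)) ∧
      StronglyInvariant (consensusMap G fun _ => fbar) (consensusSet fun _ => fbar) := by
  refine ⟨fun I x hx => ?_, fun I x hx => ?_, fun x₀ hx₀ I x hx hx0 t ht =>
    hx.1.mem_consensusSet hmono (hx0 ▸ hx₀) ht⟩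
  · refine isBounded_iff_forall_norm_le.2 ⟨‖x 0‖, ?_⟩
    rintro _ ⟨t, ht, rfl⟩
    exact (pi_norm_le_iff_of_nonneg (norm_nonneg _)).2 fun i => hx.abs_le hmono ht i
  · have hI := hx.eq_Ici hmono
    subst hI
    obtain ⟨r, hr⟩ := hG.exists_root
    refine ⟨rfl, IsTrajectory.convergesToSet G.nonneg hr hmono (fun T => ?_)
      fun t ht i => hx.1.abs_le hmono (t := t) ht i⟩
    exact (hx.1.isTrajectory hmono (le_max_right T 0)).mono le_rfl (le_max_left T 0)
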